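/- **Model.** Let $t,n$ be integers with $2t<n$. There are $n$ sequential asynchronous processes $p_1,\dots,p_n$, one of which, $p_w$, is the writer. In a run at most $t$ processes crash (possibly in the middle of a series of sends, in which case an arbitrary subset of the messages is sent); a process that never crashes is *correct*. Each ordered pair of processes is connected by a channel that neither loses, corrupts, duplicates nor creates messages and need not be FIFO; there is no bound on transit times. Each process invokes operations at arbitrary times, one at a time. A wait statement suspends only the code it occurs in; the code between two wait statements of a process is executed without interruption by other code of that process. A run is *fair* if at every correct process a message reception, or the exit from a wait statement, that remains possible forever eventually takes place. **Algorithm.** Process $p_i$ has arrays $history_i[0..]$ with $history_i[0]=v_0$ (the initial value of the register), and $w\_sync_i[1..n]$, $r\_sync_i[1..n]$, initially all $0$. The messages are WRITE$(b,v)$ with a bit $b$ and a value $v$, READ$()$ and PROCEED$()$. * write$(v)$, invoked by $p_w$ only: $wsn\leftarrow w\_sync_w[w]+1$; $w\_sync_w[w]\leftarrow wsn$; $history_w[wsn]\leftarrow v$; send WRITE$(wsn \bmod 2,v)$ to each $p_j$ with $w\_sync_w[j]=wsn-1$; wait until at least $n-t$ indices $j$ satisfy $w\_sync_w[j]=wsn$;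 return. * read$()$, invoked by any $p_i$: $rsn\leftarrow r\_sync_i[i]+1$; $r\_sync_i[i]\leftarrow rsn$; send READ$()$ to every $p_j$, $j\ne i$; wait until at least $n-t$ indices $j$ satisfy $r\_sync_i[j]=rsn$; $sn\leftarrow w\_sync_i[i]$; wait until at least $n-t$ indices $j$ satisfy $w\_sync_i[j]\ge sn$; return $history_i[sn]$. In any of its reads the writer may instead directly return $history_w[sn]$ with $sn=w\_sync_w[w]$. * When $p_i$ receives WRITE$(b,v)$ from $p_j$: wait until $b=(w\_sync_i[j]+1)\bmod 2$; $wsn\leftarrow w\_sync_i[j]+1$; if $wsn=w\_sync_i[i]+1$, then $w\_sync_i[i]\leftarrow wsn$, $history_i[wsn]\leftarrow v$, and send WRITE$(wsn\bmod 2,v)$ to each $p_\ell$ with $w\_sync_i[\ell]=wsn-1$; otherwise, if $wsn<w\_sync_i[i]$, send WRITE$((wsn+1)\bmod 2,history_i[wsn+1])$ to $p_j$; in all cases finally $w\_sync_i[j]\leftarrow wsn$. * When $p_i$ receives READ$()$ from $p_j$: $sn\leftarrow w\_sync_i[i]$; wait until $w\_sync_i[j]\ge sn$; send PROCEED$()$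 to $p_j$. * When $p_i$ receives PROCEED$()$ from $p_j$: $r\_sync_i[j]\leftarrow r\_sync_i[j]+1$. **Theorem.** The algorithm implements a single-writer multi-reader atomic register. That is, for every run: 1. (Liveness) If the run is fair, every operation invoked by a correct process terminates. 2. (Atomicity) Whether or not the run is fair, there are a set $S$ of invoked operations containing all the operations that terminate, and an arrangement of $S$ in a finite or infinite sequence, such that an operation of $S$ that terminates before another operation of $S$ starts comes earlier in the sequence, and each terminated read returns the value written by the closest write that precedes it in the sequence, or $v_0$ if no write precedes it. 3. Moreover, let the index of a terminated read be the number $sn$ for which it returns $history_i[sn]$. A read of index $x$ returns the $x$-th written value ($v_0$ if $x=0$), and: (no read from the future) if a read of index $x$ terminates before the $y$-th write starts, then $x<y$; (no overwritten value is read) if the $x$-th write terminates before a read of index $y$ starts, then $x\le y$; (no new/old inversion) if a read of index $x$ terminates before a read of index $y$ starts, then $x\le y$. -/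

import Mathlib

namespace TwoBit

/-- The four message types. `write b v` is the message WRITE0(v) if `b = false` and WRITE1(v) if
`b = true`. No message carries anything besides its type and possibly a data value. -/
inductive Msg (V : Type*) where
  | write (b : Bool) (v : V)
  | read
  | proceed

/-- Where a (sequential) process stands in the operation it is currently executing. -/
inductive Pc where
  /-- no operation is being executed -/
  | idle
  /-- waiting in a write operation, with its local variable `wsn` -/
  | writing (wsn : ℕ)
  /-- in the first wait statement of a read operation, with its local variable `rsn` -/
  | reading (rsn : ℕ)
  /-- in the second wait statement of a read operation, with its local variable `sn` -/
  | confirming (sn : ℕ)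
  /-- in a read operation of the writer that directly returns its most recent value -/
  | direct (sn : ℕ)

/-- The local state of a process. -/
structure LocalState (n : ℕ) (V : Type*) where
  /-- the array `history`; only the entries `0, …, wSync i` of process `i` have been assigned -/
  history : ℕ → V
  /-- the array `w_sync` -/
  wSync : Fin n → ℕ
  /-- the array `r_sync` -/
  rSync : Fin n → ℕ
  /-- the progress of the current operation -/
  pc : Pc
  /-- the messages WRITE(b,v) received from `j` whose handler is still in its wait statement -/
  waitW : Multiset (Fin n × Bool × V)
  /-- the messages READ received from `j` whose handler is still in its wait statement, together
  with the local variable `sn` of that handler -/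
  waitR : Multiset (Fin n × ℕ)

/-- A global state: the local states, the messages in transit (`chan p q` is the unordered channel
from `p` to `q`) and the processes that have crashed so far. -/
structure Config (n : ℕ) (V : Type*) where
  loc : Fin n → LocalState n V
  chan : Fin n → Fin n → Multiset (Msg V)
  crashed : Finset (Fin n)

/-- The atomic blocks of code that a process executes: the pieces of code between two wait
statements. -/
inductive Action (n : ℕ) (V : Type*) where
  /-- invocation of `write(v)`, up to the wait statement -/
  | invokeWrite (v : V)
  /-- end of the wait statement of a write, and return -/
  | returnWrite
  /-- invocation of `read()`, up to the first wait statement -/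
  | invokeRead
  /-- end of the first wait statement of a read; the index `sn` of the result is determined -/
  | confirmRead
  /-- invocation of `read()` by the writer, when it chooses to return its last value directly -/
  | invokeDirectRead
  /-- end of the second wait statement of a read (none in a direct read); `history[sn]` is
  returned -/
  | returnRead (sn : ℕ)
  /-- reception of the message `m` from process `j`, up to the wait statement of the handler -/
  | receive (j : Fin n) (m : Msg V)
  /-- end of the wait statement of the handler of WRITE(b,v) from `j`, and rest of the handler -/
  | handleWrite (j : Fin n) (b : Bool) (v : V)
  /-- end of the wait statement of the handler of READ from `j`, and rest of the handler -/
  | handleRead (j : Fin n) (sn : ℕ)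

variable {n : ℕ} {V : Type*}

/-- The condition on the local state `s` of process `i` under which it can execute a block:
the value of its program counter, and the predicate of the wait statement that it leaves. Here `w`
is the writer and `t` the bound on the number of crashes. -/
def LocalState.Guard (t : ℕ) (w i : Fin n) (s : LocalState n V) : Action n V → Prop
  | .invokeWrite _ => i = w ∧ s.pc = .idle
  | .returnWrite => ∃ wsn, s.pc = .writing wsn ∧
      n - t ≤ (Finset.univ.filter fun j => s.wSync j = wsn).card
  | .invokeRead => s.pc = .idle
  | .confirmRead => ∃ rsn, s.pc = .reading rsn ∧
      n - t ≤ (Finset.univ.filter fun j => s.rSync j = rsn).card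
  | .invokeDirectRead => i = w ∧ s.pc = .idle
  | .returnRead sn =>
      (s.pc = .confirming sn ∧ n - t ≤ (Finset.univ.filter fun j => sn ≤ s.wSync j).card) ∨
        s.pc = .direct sn
  | .receive _ _ => True
  | .handleWrite j b v => (j, b, v) ∈ s.waitW ∧ b = Nat.bodd (s.wSync j + 1)
  | .handleRead j sn => (j, sn) ∈ s.waitR ∧ sn ≤ s.wSync j

/-- First part of the processing of a value `v` with sequence number `wsn` that is new to
process `i`: `w_sync[i] ← wsn; history[wsn] ← v`. -/
def LocalState.learn (i : Fin n) (s : LocalState n V) (wsn : ℕ) (v : V) : LocalState n V :=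
  { s with
    wSync := Function.update s.wSync i wsn
    history := Function.update s.history wsn v }

/-- Second part: for each `q` such that `w_sync[q] = wsn - 1`, send WRITE(wsn mod 2, v) to `q`. -/
def LocalState.forward (s : LocalState n V) (wsn : ℕ) (v : V) (q : Fin n) : Multiset (Msg V) :=
  if s.wSync q + 1 = wsn then {.write (Nat.bodd wsn) v} else 0

open Classical in
/-- The local state of process `i` after a block executed in the local state `s`. -/
noncomputable def LocalState.exec (i : Fin n) (s : LocalState n V) :
    Action n V → LocalState n V
  | .invokeWrite v => { s.learn i (s.wSync i + 1) v with pc := .writing (s.wSync i + 1) }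
  | .returnWrite => { s with pc := .idle }
  | .invokeRead =>
      { s with rSync := Function.update s.rSync i (s.rSync i + 1)
               pc := .reading (s.rSync i + 1) }
  | .confirmRead => { s with pc := .confirming (s.wSync i) }
  | .invokeDirectRead => { s with pc := .direct (s.wSync i) }
  | .returnRead _ => { s with pc := .idle }
  | .receive j (.write b v) => { s with waitW := (j, b, v) ::ₘ s.waitW }
  | .receive j .read => { s with waitR := (j, s.wSync i) ::ₘ s.waitR }
  | .receive j .proceed => { s with rSync := Function.update s.rSync j (s.rSync j + 1) }
  | .handleWrite j b v =>
      let wsn := s.wSync j + 1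
      let s' := if wsn = s.wSync i + 1 then s.learn i wsn v else s
      { s' with wSync := Function.update s'.wSync j wsn
                waitW := s.waitW.erase (j, b, v) }
  | .handleRead j sn => { s with waitR := s.waitR.erase (j, sn) }

/-- The messages that process `i` sends to `q` in a block executed in the local state `s`. -/
def LocalState.sends (i : Fin n) (s : LocalState n V) : Action n V → Fin n → Multiset (Msg V)
  | .invokeWrite v, q => (s.learn i (s.wSync i + 1) v).forward (s.wSync i + 1) v q
  | .invokeRead, q => if q ≠ i then {.read} else 0
  | .handleWrite j _ v, q =>
      let wsn := s.wSync j + 1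
      if wsn = s.wSync i + 1 then (s.learn i wsn v).forward wsn v q
      else if wsn < s.wSync i ∧ q = j then
        {.write (Nat.bodd (wsn + 1)) (s.history (wsn + 1))}
      else 0
  | .handleRead j _, q => if q = j then {.proceed} else 0
  | _, _ => 0

/-- The initial configuration, where `v₀` is the initial value of the register. -/
def Config.start (n : ℕ) {V : Type*} (v₀ : V) : Config n V where
  loc _ :=
    { history := fun _ => v₀, wSync := fun _ => 0, rSync := fun _ => 0
      pc := .idle, waitW := 0, waitR := 0 }
  chan _ _ := 0
  crashed := ∅

/-- Process `i` can execute the block `a`. A message is received only if it is in transit. -/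
def Config.Enabled (t : ℕ) (w : Fin n) (c : Config n V) (i : Fin n) (a : Action n V) : Prop :=
  i ∉ c.crashed ∧ (c.loc i).Guard t w i a ∧ ∀ j m, a = .receive j m → m ∈ c.chan j i

open Classical in
/-- The configuration after process `i` has executed the block `a`, where only the messages to the
processes in `D` have been sent. -/
noncomputable def Config.exec (c : Config n V) (i : Fin n) (a : Action n V)
    (D : Finset (Fin n)) : Config n V where
  loc := Function.update c.loc i ((c.loc i).exec i a)
  chan p q :=
    (match a with
      | .receive j m => if p = j ∧ q = i then (c.chan p q).erase m else c.chan p q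
      | _ => c.chan p q) +
    (if p = i ∧ q ∈ D then (c.loc i).sends i a q else 0)
  crashed := c.crashed

/-- What can happen at an instant of a run. -/
inductive Event (n : ℕ) (V : Type*) where
  /-- nothing -/
  | tick
  /-- process `i` executes the block `a` -/
  | step (i : Fin n) (a : Action n V)
  /-- process `i` crashes between two blocks -/
  | crash (i : Fin n)
  /-- process `i` crashes in the course of the block `a`, after it has sent the messages of the
  block that are addressed to the processes in `D` (a block sends at most one message to each
  process), and no others -/
  | crashIn (i : Fin n) (a : Action n V) (D : Finset (Fin n))

/-- The transition relation. -/
def Step (t : ℕ) (w : Fin n) (c : Config n V) (e : Event n V) (c' : Config n V) : Prop :=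
  match e with
  | .tick => c' = c
  | .step i a => c.Enabled t w i a ∧ c' = c.exec i a Finset.univ
  | .crash i => i ∉ c.crashed ∧ c' = { c with crashed := insert i c.crashed }
  | .crashIn i a D =>
      c.Enabled t w i a ∧ c' = { c.exec i a D with crashed := insert i c.crashed }

/-- The block executed (possibly only in part) in an event, with the process executing it. -/
def Event.action : Event n V → Option (Fin n × Action n V)
  | .step i a => some (i, a)
  | .crashIn i a _ => some (i, a)
  | _ => none

/-- The invocations of operations. -/
inductive Action.IsInvocation : Action n V → Prop
  | write (v : V) : Action.IsInvocation (.invokeWrite v)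
  | read : Action.IsInvocation .invokeRead
  | directRead : Action.IsInvocation .invokeDirectRead

/-- The invocations of read operations. -/
inductive Action.IsReadInvocation : Action n V → Prop
  | read : Action.IsReadInvocation .invokeRead
  | directRead : Action.IsReadInvocation .invokeDirectRead

/-- The returns from operations. -/
inductive Action.IsReturn : Action n V → Prop
  | write : Action.IsReturn .returnWrite
  | read (sn : ℕ) : Action.IsReturn (.returnRead sn)

/-- A run of the algorithm with `n` processes, writer `w` and initial value `v₀`, in which at most
`t` processes crash. The invocations are chosen arbitrarily by the processes (each process is
sequential). Fairness is not included. -/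
structure Run (n t : ℕ) {V : Type*} (w : Fin n) (v₀ : V) where
  cfg : ℕ → Config n V
  ev : ℕ → Event n V
  cfg_zero : cfg 0 = Config.start n v₀
  step : ∀ τ, Step t w (cfg τ) (ev τ) (cfg (τ + 1))
  crash_le : {i | ∃ τ, i ∈ (cfg τ).crashed}.ncard ≤ t

namespace Run

variable {t : ℕ} {w : Fin n} {v₀ : V}

/-- A process is correct in a run if it never crashes. -/
def Correct (r : Run n t w v₀) (i : Fin n) : Prop :=
  ∀ τ, i ∉ (r.cfg τ).crashed

/-- Every correct process keeps executing its algorithm, and message transit times are finite: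
a reception, or the end of a wait statement, that remains possible forever at a correct process
eventually takes place. Nobody is forced to invoke an operation. -/
def Fair (r : Run n t w v₀) : Prop :=
  ∀ i, r.Correct i → ∀ a : Action n V, ¬ a.IsInvocation →
    ∀ τ, (∀ σ, τ ≤ σ → (r.cfg σ).Enabled t w i a) → ∃ σ, τ ≤ σ ∧ r.ev σ = .step i a

/-- At time `τ`, process `i` invokes an operation. An operation of a run is identified with the
time of its invocation. -/
def InvokedBy (r : Run n t w v₀) (τ : ℕ) (i : Fin n) : Prop :=
  ∃ a : Action n V, (r.ev τ).action = some (i, a) ∧ a.IsInvocation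

/-- An operation is invoked at time `τ`. -/
def IsOp (r : Run n t w v₀) (τ : ℕ) : Prop :=
  ∃ i, r.InvokedBy τ i

/-- The operation `write(v)` is invoked at time `τ`. -/
def IsWriteOf (r : Run n t w v₀) (τ : ℕ) (v : V) : Prop :=
  ∃ i, (r.ev τ).action = some (i, .invokeWrite v)

/-- A write operation is invoked at time `τ`. -/
def IsWrite (r : Run n t w v₀) (τ : ℕ) : Prop :=
  ∃ v, r.IsWriteOf τ v

/-- Process `i` returns from an operation at time `τ`. -/
def ReturnBy (r : Run n t w v₀) (τ : ℕ) (i : Fin n) : Prop :=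
  ∃ a : Action n V, (r.ev τ).action = some (i, a) ∧ a.IsReturn

/-- The operation invoked at time `τ` terminates at time `τ'`: the first return of its process
after `τ` takes place at `τ'`. -/
def TerminatesAt (r : Run n t w v₀) (τ τ' : ℕ) : Prop :=
  ∃ i, r.InvokedBy τ i ∧ τ < τ' ∧ r.ReturnBy τ' i ∧ ∀ σ, τ < σ → σ < τ' → ¬ r.ReturnBy σ i

/-- `τ` is a read operation that terminates by returning `v`, which is the entry of index `sn` in
the history of the reading process. -/
def ReadReturns (r : Run n t w v₀) (τ sn : ℕ) (v : V) : Prop :=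
  ∃ (i : Fin n) (a : Action n V) (τ' : ℕ), (r.ev τ).action = some (i, a) ∧ a.IsReadInvocation ∧
    r.TerminatesAt τ τ' ∧ (r.ev τ').action = some (i, .returnRead sn) ∧
    v = ((r.cfg τ').loc i).history sn

/-- The operation `a` terminates before the operation `b` starts. -/
def Precedes (r : Run n t w v₀) (a b : ℕ) : Prop :=
  r.IsOp b ∧ ∃ τ', r.TerminatesAt a τ' ∧ τ' < b

/-- Liveness: an operation invoked by a correct process terminates. -/
def Live (r : Run n t w v₀) : Prop :=
  ∀ τ i, r.InvokedBy τ i → r.Correct i → ∃ τ', r.TerminatesAt τ τ'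

/-- Atomicity (linearizability): there are a set `S` of operations, containing all those that
terminate, and an arrangement of `S` in a finite or infinite sequence (`pos` gives the positions),
which respects the real-time order, and in which each read returns the value written by the closest
preceding write, or the initial value if there is no preceding write. -/
def Atomic (r : Run n t w v₀) : Prop :=
  ∃ (S : Set ℕ) (pos : ℕ → ℕ),
    (∀ a ∈ S, r.IsOp a) ∧
    (∀ a τ', r.TerminatesAt a τ' → a ∈ S) ∧
    Set.InjOn pos S ∧
    (∀ a ∈ S, ∀ b ∈ S, r.Precedes a b → pos a < pos b) ∧
    (∀ a ∈ S, ∀ sn v, r.ReadReturns a sn v →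
      (∃ b ∈ S, r.IsWriteOf b v ∧ pos b < pos a ∧
        ∀ c ∈ S, r.IsWrite c → pos c < pos a → pos c ≤ pos b) ∨
      (v = v₀ ∧ ∀ c ∈ S, r.IsWrite c → ¬ pos c < pos a))

/-- `τ` is the `x`-th write operation of the run, `x ≥ 1`, and it writes `v`. -/
def IsNthWrite (r : Run n t w v₀) (x τ : ℕ) (v : V) : Prop :=
  r.IsWriteOf τ v ∧ {σ | σ ≤ τ ∧ r.IsWrite σ}.ncard = x

/-- A read that returns the entry of index `x` returns the `x`-th written value (the initial value
if `x = 0`). -/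
def ReadsWrittenValues (r : Run n t w v₀) : Prop :=
  ∀ a x v, r.ReadReturns a x v → (x = 0 ∧ v = v₀) ∨ ∃ b, r.IsNthWrite x b v

/-- No read from the future: if a read of index `x` terminates before the `y`-th write starts, then
`x < y`. -/
def NoReadFromFuture (r : Run n t w v₀) : Prop :=
  ∀ a x v b y u, r.ReadReturns a x v → r.IsNthWrite y b u → r.Precedes a b → x < y

/-- No overwritten value is read: if the `x`-th write terminates before a read of index `y` starts,
then `x ≤ y`. -/
def NoOverwrittenRead (r : Run n t w v₀) : Prop :=
  ∀ a x v b y u, r.IsNthWrite x a v → r.ReadReturns b y u → r.Precedes a b → x ≤ y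

/-- No new/old inversion: if a read of index `x` terminates before a read of index `y` starts, then
`x ≤ y`. -/
def NoNewOldInversion (r : Run n t w v₀) : Prop :=
  ∀ a x v b y u, r.ReadReturns a x v → r.ReadReturns b y u → r.Precedes a b → x ≤ y

end Run

end TwoBit

/-!
Number the written values `1, 2, …` in the order of the writes, and `v₀` by `0`. The key point is
that `w_sync_i[i]` is the number of the most recent value known to process `i`, and that
`w_sync_i[j]` is the number of WRITE messages of `j` that `i` has processed, although the messages
carry no numbers. Two processes exchange WRITE messages in a ping-pong: the message number `x + 1`
is sent from `i` to `j` only after the message number `x` from `j` has been processed. So in each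
direction at most two messages are in flight, with consecutive numbers, and the parity bit picks
the older one, even though channels are not FIFO. This is the clause `flow` of the invariant `Inv`,
and `Inv.eq_of_mem_inFlight` is the resulting statement about the bit. It follows that histories
agree with the numbering of the values and that no process overestimates what another one knows.

*Safety.* Call a value known at a time if `n - t` processes know it (`Known`). When a write returns,
its value is known; when a read returns, its result is known, either by its second wait statement
or, for a direct read of the writer, because the last write has returned. Conversely, a read that
starts when the value number `x` is known has index at least `x` (`Known.le_of_readReturns`): since
`2 * t < n`, some process `j` that knew the value at the start of the read has answered the READ
message of the reader `i`, and it did so only once `w_sync_j[i] ≥ x`, so `i` knew the value then.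
This gives the three properties of the indices.

*Atomicity.* Operations are sorted by index, the write of a value before the reads that return it,
and these reads by starting time. By the properties of the indices this order extends the real-time
order, and every operation that is included has finitely many predecessors, so that the order can be
turned into a sequence. The last write is included only if it terminates or its value is read.

*Liveness.* By induction on `x`, in a fair run the message number `x` between two correct processes
is sent and processed (`Fair.exists_le_wSync`). As at least `n - t` processes are correct, all the
wait statements of a correct process come to an end.
-/

namespace TwoBit

variable {n : ℕ} {V : Type*}

/-! ### Messages in transit -/

/-- The bit and the value carried by a WRITE message. -/
def Msg.payload : Msg V → Option (Bool × V)
  | .write b v => some (b, v)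
  | _ => none

def Msg.isRead : Msg V → Bool
  | .read => true
  | _ => false

def Msg.isProceed : Msg V → Bool
  | .proceed => true
  | _ => false

/-- The contents of the WRITE messages from `p` to `q` that have been sent but not yet processed:
they are in the channel, or their handler is in its wait statement. -/
def Config.inFlight (c : Config n V) (p q : Fin n) : Multiset (Bool × V) :=
  (c.chan p q).filterMap Msg.payload + ((c.loc q).waitW.filter fun e => e.1 = p).map Prod.snd

/-- The contents of the WRITE messages for the values number `m + 1, …, k`, where `H x` is the
value number `x`. -/
def segment (H : ℕ → V) (m k : ℕ) : Multiset (Bool × V) :=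
  (Multiset.Ioc m k).map fun x => (Nat.bodd x, H x)

theorem segment_of_le (H : ℕ → V) {m k : ℕ} (h : k ≤ m) : segment H m k = 0 := by
  simp [segment, Multiset.Ioc, Finset.Ioc_eq_empty_of_le h]

theorem segment_add (H : ℕ → V) {m k l : ℕ} (h : m ≤ k) (h' : k ≤ l) :
    segment H m k + segment H k l = segment H m l := by
  simp only [segment, ← Multiset.map_add, Multiset.Ioc]
  rw [← Finset.Ioc_union_Ioc_eq_Ioc h h', ← Finset.disjUnion_eq_union _ _
    (Finset.Ioc_disjoint_Ioc_of_le le_rfl), Finset.disjUnion_val]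

theorem segment_succ (H : ℕ → V) (m : ℕ) :
    segment H m (m + 1) = {(Nat.bodd (m + 1), H (m + 1))} := by
  simp [segment, Multiset.Ioc]

theorem mem_segment {H : ℕ → V} {m k : ℕ} {e : Bool × V} :
    e ∈ segment H m k ↔ ∃ x, m < x ∧ x ≤ k ∧ e = (Nat.bodd x, H x) := by
  simp [segment, Multiset.Ioc, and_assoc, eq_comm]

theorem segment_congr {H H' : ℕ → V} {m k : ℕ} (h : ∀ x ≤ k, H x = H' x) :
    segment H m k = segment H' m k :=
  Multiset.map_congr rfl fun x hx => by
    rw [h x (by simp [Multiset.Ioc] at hx; exact hx.2)]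

theorem mem_inFlight {c : Config n V} {p q : Fin n} {b : Bool} {v : V} :
    (b, v) ∈ c.inFlight p q ↔ .write b v ∈ c.chan p q ∨ (p, b, v) ∈ (c.loc q).waitW := by
  simp only [Config.inFlight, Multiset.mem_add, Multiset.mem_filterMap, Multiset.mem_map,
    Multiset.mem_filter]
  refine or_congr ⟨?_, fun h => ⟨_, h, rfl⟩⟩ ⟨?_, fun h => ⟨_, ⟨h, rfl⟩, rfl⟩⟩
  · rintro ⟨_ | _ | _, h, h'⟩ <;> simp_all [Msg.payload]
  · rintro ⟨⟨p', b', v'⟩, ⟨h, rfl⟩, h'⟩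
    cases h'
    exact h

/-! ### The effect of one block on the local state -/

namespace LocalState

variable {i : Fin n} {s : LocalState n V}

theorem exec_handleWrite_wSync (j : Fin n) (b : Bool) (v : V) :
    (s.exec i (.handleWrite j b v)).wSync =
      if s.wSync j = s.wSync i then
        Function.update (Function.update s.wSync i (s.wSync j + 1)) j (s.wSync j + 1)
      else Function.update s.wSync j (s.wSync j + 1) := by
  simp only [exec, Nat.add_right_cancel_iff]
  split_ifs <;> rfl

theorem exec_handleWrite_history (j : Fin n) (b : Bool) (v : V) :
    (s.exec i (.handleWrite j b v)).history =
      if s.wSync j = s.wSync i then Function.update s.history (s.wSync j + 1) v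
      else s.history := by
  simp only [exec, Nat.add_right_cancel_iff]
  split_ifs <;> rfl

theorem exec_handleWrite_pc (j : Fin n) (b : Bool) (v : V) :
    (s.exec i (.handleWrite j b v)).pc = s.pc := by
  simp only [exec]
  split_ifs <;> rfl

theorem exec_handleWrite_rSync (j : Fin n) (b : Bool) (v : V) :
    (s.exec i (.handleWrite j b v)).rSync = s.rSync := by
  simp only [exec]
  split_ifs <;> rfl

theorem exec_handleWrite_waitR (j : Fin n) (b : Bool) (v : V) :
    (s.exec i (.handleWrite j b v)).waitR = s.waitR := by
  simp only [exec]
  split_ifs <;> rfl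

open Classical in
theorem exec_handleWrite_waitW (j : Fin n) (b : Bool) (v : V) :
    (s.exec i (.handleWrite j b v)).waitW = s.waitW.erase (j, b, v) := by
  simp only [exec]

theorem wSync_le_exec (a : Action n V) (j : Fin n) : s.wSync j ≤ (s.exec i a).wSync j := by
  cases a with
  | receive k m => cases m <;> exact le_rfl
  | handleWrite k b v =>
    rw [exec_handleWrite_wSync]
    split_ifs with h <;> simp only [Function.update_apply] <;> split_ifs <;> subst_vars <;> omega
  | invokeWrite v =>
    simp only [exec, learn, Function.update_apply]
    split_ifs <;> subst_vars <;> omega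
  | _ => exact le_rfl

/-- The blocks that change `w_sync` are the invocations of writes and the handlers of WRITE. -/
theorem exec_wSync_of_ne {a : Action n V} (h₁ : ∀ v, a ≠ .invokeWrite v)
    (h₂ : ∀ j b v, a ≠ .handleWrite j b v) : (s.exec i a).wSync = s.wSync := by
  cases a with
  | receive k m => cases m <;> rfl
  | handleWrite k b v => exact (h₂ _ _ _ rfl).elim
  | invokeWrite v => exact (h₁ _ rfl).elim
  | _ => rfl

theorem exec_history_of_ne {a : Action n V} (h₁ : ∀ v, a ≠ .invokeWrite v)
    (h₂ : ∀ j b v, a ≠ .handleWrite j b v) : (s.exec i a).history = s.history := by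
  cases a with
  | receive k m => cases m <;> rfl
  | handleWrite k b v => exact (h₂ _ _ _ rfl).elim
  | invokeWrite v => exact (h₁ _ rfl).elim
  | _ => rfl

theorem sends_payload_of_ne {a : Action n V} (h₁ : ∀ v, a ≠ .invokeWrite v)
    (h₂ : ∀ j b v, a ≠ .handleWrite j b v) (q : Fin n) :
    (s.sends i a q).filterMap Msg.payload = 0 := by
  cases a with
  | handleWrite k b v => exact (h₂ _ _ _ rfl).elim
  | invokeWrite v => exact (h₁ _ rfl).elim
  | invokeRead =>
    simp only [sends]
    split_ifs
    · exact Multiset.filterMap_cons_none _ _ rfl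
    · rfl
  | handleRead k sn =>
    simp only [sends]
    split_ifs
    · exact Multiset.filterMap_cons_none _ _ rfl
    · rfl
  | _ => rfl

end LocalState

/-! ### The local invariant -/

/-- What is always true of the local state of process `i`, where `H x` is the value number `x`. -/
structure LocalInv (t : ℕ) (w i : Fin n) (H : ℕ → V) (s : LocalState n V) : Prop where
  sync_le : ∀ j, s.wSync j ≤ s.wSync i
  history_eq : ∀ x ≤ s.wSync i, s.history x = H x
  waitW_ne : ∀ e ∈ s.waitW, e.1 ≠ i
  waitR_ne : ∀ e ∈ s.waitR, e.1 ≠ i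
  writing : ∀ x, s.pc = .writing x → i = w ∧ x = s.wSync i
  reading : ∀ x, s.pc = .reading x → x = s.rSync i
  confirming : ∀ x, s.pc = .confirming x → x ≤ s.wSync i
  direct : ∀ x, s.pc = .direct x → i = w ∧ x = s.wSync i
  /-- Between its writes, the writer knows that its last value has reached a quorum. -/
  quorum : i = w → (∀ x, s.pc ≠ .writing x) →
    n - t ≤ (Finset.univ.filter fun j => s.wSync i ≤ s.wSync j).card

/-- The block `a` of process `i` agrees with the numbering `H` of the written values: the values
that it assigns to the history are the right ones, the writer learns no value from others, and the
block does not deal with a message of `i` to itself. -/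
def Action.Fits (w i : Fin n) (H : ℕ → V) (s : LocalState n V) : Action n V → Prop
  | .invokeWrite v => H (s.wSync i + 1) = v
  | .receive j _ => j ≠ i
  | .handleWrite j _ v => j ≠ i ∧ (s.wSync j = s.wSync i → i ≠ w ∧ H (s.wSync j + 1) = v)
  | .handleRead j _ => j ≠ i
  | _ => True

namespace LocalInv

variable {t : ℕ} {w i : Fin n} {H : ℕ → V} {s : LocalState n V}

theorem exec (h : LocalInv t w i H s) {a : Action n V} (hg : s.Guard t w i a)
    (hf : a.Fits w i H s) : LocalInv t w i H (s.exec i a) := by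
  obtain ⟨h1, h2, h3, h4, h5, h6, h7, h8, h9⟩ := h
  cases a with
  | invokeWrite v =>
    simp only [Action.Fits] at hf
    refine ⟨fun j => ?_, fun x hx => ?_, h3, h4, ?_, ?_, ?_, ?_, ?_⟩
    · have := h1 j
      simp only [LocalState.exec, LocalState.learn, Function.update_apply]
      split_ifs <;> simp
      omega
    · simp only [LocalState.exec, LocalState.learn, Function.update_apply, if_true] at hx ⊢
      split_ifs with hx'
      · rw [hx', hf]
      · exact h2 x (by omega)
    all_goals simp [LocalState.exec, LocalState.learn, hg.1]
  | returnWrite =>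
    obtain ⟨x, hx, hq⟩ := hg
    refine ⟨h1, h2, h3, h4, nofun, nofun, nofun, nofun,
      fun hw _ => hq.trans (Finset.card_le_card fun j hj => ?_)⟩
    exact Finset.mem_filter.2
      ⟨Finset.mem_univ _, ((Finset.mem_filter.1 hj).2.trans (h5 x hx).2).ge⟩
  | invokeRead =>
    refine ⟨h1, h2, h3, h4, nofun, fun x hx => ?_, nofun, nofun, fun hw _ => h9 hw ?_⟩
    · simpa [LocalState.exec] using (Pc.reading.inj hx).symm
    · rw [show s.pc = .idle from hg]
      nofun
  | confirmRead =>
    obtain ⟨x, hx, hq⟩ := hg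
    refine ⟨h1, h2, h3, h4, nofun, nofun, fun x hx => (Pc.confirming.inj hx).ge, nofun,
      fun hw _ => h9 hw ?_⟩
    rw [hx]
    nofun
  | invokeDirectRead =>
    refine ⟨h1, h2, h3, h4, nofun, nofun, nofun, fun x hx => ⟨hg.1, (Pc.direct.inj hx).symm⟩,
      fun hw _ => h9 hw ?_⟩
    rw [hg.2]
    nofun
  | returnRead sn =>
    refine ⟨h1, h2, h3, h4, nofun, nofun, nofun, nofun, fun hw _ => h9 hw ?_⟩
    rcases hg with hg | hg
    · rw [hg.1]
      nofun
    · rw [hg]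
      nofun
  | receive j m =>
    simp only [Action.Fits] at hf
    cases m with
    | write b v =>
      refine ⟨h1, h2, ?_, h4, h5, h6, h7, h8, h9⟩
      simp only [LocalState.exec, Multiset.mem_cons]
      rintro e (rfl | he)
      exacts [hf, h3 e he]
    | read =>
      refine ⟨h1, h2, h3, ?_, h5, h6, h7, h8, h9⟩
      simp only [LocalState.exec, Multiset.mem_cons]
      rintro e (rfl | he)
      exacts [hf, h4 e he]
    | proceed =>
      refine ⟨h1, h2, h3, h4, h5, fun x hx => ?_, h7, h8, h9⟩
      simp only [LocalState.exec] at hx ⊢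
      rw [Function.update_of_ne hf.symm]
      exact h6 x hx
  | handleWrite j b v =>
    obtain ⟨hj, hl⟩ := hf
    have hmono := LocalState.wSync_le_exec (i := i) (s := s) (.handleWrite j b v)
    have hji := h1 j
    have hself : (s.exec i (.handleWrite j b v)).wSync i =
        if s.wSync j = s.wSync i then s.wSync j + 1 else s.wSync i := by
      rw [LocalState.exec_handleWrite_wSync]
      split_ifs <;> simp [Function.update_of_ne hj.symm]
    have hw : i = w → (s.exec i (.handleWrite j b v)).wSync i = s.wSync i := fun hw => by
      rw [hself, if_neg fun h => (hl h).1 hw]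
    refine ⟨fun k => ?_, fun x hx => ?_, fun e he => ?_, ?_, fun x hx => ?_, fun x hx => ?_,
      fun x hx => ?_, fun x hx => ?_, fun hiw hx => ?_⟩
    · rw [hself, LocalState.exec_handleWrite_wSync]
      have := h1 k
      split_ifs <;> simp only [Function.update_apply] <;> split_ifs <;> omega
    · rw [hself] at hx
      rw [LocalState.exec_handleWrite_history]
      split_ifs at hx ⊢ with he
      · simp only [Function.update_apply]
        split_ifs with hx'
        · rw [hx', (hl he).2]
        · exact h2 x (by omega)
      · exact h2 x hx
    · rw [LocalState.exec_handleWrite_waitW] at he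
      classical exact h3 e (Multiset.mem_of_mem_erase he)
    · rwa [LocalState.exec_handleWrite_waitR]
    · rw [LocalState.exec_handleWrite_pc] at hx
      have := h5 x hx
      exact ⟨this.1, this.2.trans (hw this.1).symm⟩
    · rw [LocalState.exec_handleWrite_pc] at hx
      rw [LocalState.exec_handleWrite_rSync]
      exact h6 x hx
    · rw [LocalState.exec_handleWrite_pc] at hx
      exact (h7 x hx).trans (hmono i)
    · rw [LocalState.exec_handleWrite_pc] at hx
      have := h8 x hx
      exact ⟨this.1, this.2.trans (hw this.1).symm⟩
    · rw [LocalState.exec_handleWrite_pc] at hx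
      rw [hw hiw]
      refine (h9 hiw hx).trans (Finset.card_le_card fun k => ?_)
      simp only [Finset.mem_filter, Finset.mem_univ, true_and]
      exact fun hk => hk.trans (hmono k)
  | handleRead j sn =>
    classical
    refine ⟨h1, h2, h3, fun e he => h4 e ?_, h5, h6, h7, h8, h9⟩
    exact Multiset.mem_of_mem_erase he

/-- The number of WRITE messages that process `i` has sent to `q` is always
`min (w_sync[i]) (w_sync[q] + 1)`, and they carry the first values in turn. -/
theorem sends_payload (h : LocalInv t w i H s) {a : Action n V} (hf : a.Fits w i H s) {q : Fin n}
    (hq : q ≠ i) :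
    (s.sends i a q).filterMap Msg.payload =
      segment H (min (s.wSync i) (s.wSync q + 1))
        (min ((s.exec i a).wSync i) ((s.exec i a).wSync q + 1)) := by
  by_cases h₁ : ∃ v, a = .invokeWrite v
  · obtain ⟨v, rfl⟩ := h₁
    simp only [Action.Fits] at hf
    have := h.sync_le q
    simp only [LocalState.sends, LocalState.exec, LocalState.forward, LocalState.learn,
      Function.update_self, Function.update_of_ne hq]
    split_ifs with hs
    · rw [← hf, show min (s.wSync i) (s.wSync q + 1) = s.wSync i by omega,
        show min (s.wSync i + 1) (s.wSync q + 1) = s.wSync i + 1 by omega, segment_succ]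
      exact Multiset.filterMap_cons_some _ _ _ rfl
    · rw [segment_of_le _ (by omega)]
      rfl
  by_cases h₂ : ∃ j b v, a = .handleWrite j b v
  · obtain ⟨j, b, v, rfl⟩ := h₂
    obtain ⟨hj, hl⟩ := hf
    have hqi := h.sync_le q
    have hji := h.sync_le j
    rw [LocalState.exec_handleWrite_wSync]
    simp only [LocalState.sends, Nat.add_right_cancel_iff]
    split_ifs with h1 h2
    · simp only [LocalState.forward, LocalState.learn, Function.update_of_ne hq,
        Function.update_of_ne hj.symm, Function.update_self, Nat.add_right_cancel_iff]
      have : (Function.update (Function.update s.wSync i (s.wSync j + 1)) j (s.wSync j + 1)) q =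
          if q = j then s.wSync j + 1 else s.wSync q := by
        simp only [Function.update_apply]
        split_ifs <;> rfl
      rw [this]
      split_ifs with h3 h4 h4
      · subst h4
        rw [show min (s.wSync i) (s.wSync q + 1) = s.wSync q by omega,
          show min (s.wSync q + 1) (s.wSync q + 1 + 1) = s.wSync q + 1 by omega, segment_succ,
          (hl h1).2]
        exact Multiset.filterMap_cons_some _ _ _ rfl
      · rw [show min (s.wSync i) (s.wSync q + 1) = s.wSync j by omega,
          show min (s.wSync j + 1) (s.wSync q + 1) = s.wSync j + 1 by omega, segment_succ,
          (hl h1).2]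
        exact Multiset.filterMap_cons_some _ _ _ rfl
      · subst h4; exact (h3 rfl).elim
      · rw [segment_of_le _ (by omega)]
        rfl
    · obtain ⟨h2, rfl⟩ := h2
      simp only [Function.update_self, Function.update_of_ne hj.symm]
      rw [show min (s.wSync i) (s.wSync q + 1) = s.wSync q + 1 by omega,
        show min (s.wSync i) (s.wSync q + 1 + 1) = s.wSync q + 1 + 1 by omega, segment_succ,
        h.history_eq _ (by omega)]
      exact Multiset.filterMap_cons_some _ _ _ rfl
    · simp only [Function.update_of_ne hj.symm, Function.update_apply]
      rw [segment_of_le _ (by split_ifs <;> subst_vars <;> omega)]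
      rfl
  push Not at h₁ h₂
  rw [LocalState.sends_payload_of_ne h₁ h₂, LocalState.exec_wSync_of_ne h₁ h₂,
    segment_of_le _ le_rfl]

end LocalInv

theorem Action.Fits.sends_self {w i : Fin n} {H : ℕ → V} {s : LocalState n V} {a : Action n V}
    (hf : a.Fits w i H s) : s.sends i a i = 0 := by
  cases a with
  | handleWrite j b v =>
    simp [LocalState.sends, LocalState.forward, LocalState.learn, hf.1.symm]
  | invokeWrite v => simp [LocalState.sends, LocalState.forward, LocalState.learn]
  | handleRead j sn =>
    simp only [Action.Fits] at hf
    simp [LocalState.sends, hf.symm]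
  | invokeRead => simp [LocalState.sends]
  | _ => rfl

/-! ### The global invariant -/

namespace Config

variable {c : Config n V} {i p q : Fin n} {a : Action n V} {D : Finset (Fin n)}

@[simp]
theorem exec_loc_self : (c.exec i a D).loc i = (c.loc i).exec i a := by
  simp [Config.exec]

theorem exec_loc_of_ne (h : p ≠ i) : (c.exec i a D).loc p = c.loc p := by
  simp [Config.exec, h]

theorem exec_chan_of_ne (hp : p ≠ i) (hq : q ≠ i) : (c.exec i a D).chan p q = c.chan p q := by
  cases a <;> simp [Config.exec, hp, hq]

theorem exec_chan_out (hq : q ≠ i) :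
    (c.exec i a D).chan i q = c.chan i q + if q ∈ D then (c.loc i).sends i a q else 0 := by
  cases a <;> simp [Config.exec, hq]

open Classical in
theorem exec_chan_in (hp : p ≠ i) (m : Msg V) :
    (c.exec i (.receive p m) D).chan p i = (c.chan p i).erase m := by
  simp [Config.exec, hp]

theorem exec_chan_in_of_ne (hp : p ≠ i) (ha : ∀ m, a ≠ .receive p m) :
    (c.exec i a D).chan p i = c.chan p i := by
  cases a with
  | receive j m =>
    have hj : p ≠ j := by rintro rfl; exact ha m rfl
    simp [Config.exec, hp, hj]
  | _ => simp [Config.exec, hp]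

theorem exec_chan_self (h : c.chan i i = 0) (hs : (c.loc i).sends i a i = 0) :
    (c.exec i a D).chan i i = 0 := by
  cases a <;> simp [Config.exec, h, hs]

/-- The number of the READ messages from `p` to `q` that are in the channel or with a waiting
handler, or whose answer is in the channel from `q` to `p`. -/
def pendingReads (c : Config n V) (p q : Fin n) : ℕ :=
  (c.chan p q).countP (fun m => m.isRead) + (c.loc q).waitR.countP (fun e => e.1 = p) +
    (c.chan q p).countP (fun m => m.isProceed)

theorem inFlight_congr {c c' : Config n V} (h : c'.chan p q = c.chan p q)
    (h' : (c'.loc q).waitW = (c.loc q).waitW) : c'.inFlight p q = c.inFlight p q := by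
  rw [inFlight, inFlight, h, h']

end Config

/-- The invariant of the runs, where `H x` is the value number `x`.

The clause `flow` says that, if `p` has sent `k` WRITE messages to `q` and `q` has processed
`m = w_sync_q[p]` of them, these were the first `m` ones and the others are in flight. Since
`k ≤ w_sync_p[q] + 1` and, in the other direction, `w_sync_p[q] ≤ w_sync_q[p] + 1`, at most two
messages are in flight, and the parity bit tells them apart. A process that has crashed in the
course of a block may have omitted its last message.

The clause `reads` does the same for READ and PROCEED: `p` has sent `r_sync_p[p]` READ messages. -/
structure Inv (t : ℕ) (w : Fin n) (H : ℕ → V) (c : Config n V) : Prop where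
  loc : ∀ i, LocalInv t w i H (c.loc i)
  le_writer : ∀ i, (c.loc i).wSync i ≤ (c.loc w).wSync w
  chan_self : ∀ i, c.chan i i = 0
  flow : ∀ p q, p ≠ q → ∃ k, (c.loc q).wSync p ≤ k ∧
    k ≤ min ((c.loc p).wSync p) ((c.loc p).wSync q + 1) ∧
    (p ∉ c.crashed → k = min ((c.loc p).wSync p) ((c.loc p).wSync q + 1)) ∧
    c.inFlight p q = segment H ((c.loc q).wSync p) k
  reads : ∀ p q, p ≠ q → c.pendingReads p q + (c.loc p).rSync q ≤ (c.loc p).rSync p ∧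
    (p ∉ c.crashed → q ∉ c.crashed →
      c.pendingReads p q + (c.loc p).rSync q = (c.loc p).rSync p)

namespace Inv

variable {t : ℕ} {w : Fin n} {H : ℕ → V} {c : Config n V}

theorem start (t : ℕ) (w : Fin n) {H : ℕ → V} {v₀ : V} (h : H 0 = v₀) :
    Inv t w H (Config.start n v₀) where
  loc i := by
    constructor
    case quorum =>
      intro _ _
      simp [Config.start]
    all_goals simp [Config.start, h]
  le_writer := by simp [Config.start]
  chan_self := by simp [Config.start]
  flow p q _ := ⟨0, by simp [Config.start], by simp [Config.start], by simp [Config.start], by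
    simp [Config.start, Config.inFlight, segment_of_le]⟩
  reads p q _ := by simp [Config.start, Config.pendingReads]

theorem congr {H' : ℕ → V} (h : Inv t w H c) (hH : ∀ x ≤ (c.loc w).wSync w, H x = H' x) :
    Inv t w H' c where
  loc i := { h.loc i with
    history_eq := fun x hx =>
      ((h.loc i).history_eq x hx).trans (hH x (hx.trans (h.le_writer i))) }
  le_writer := h.le_writer
  chan_self := h.chan_self
  flow p q hpq := by
    obtain ⟨k, h1, h2, h3, h4⟩ := h.flow p q hpq
    refine ⟨k, h1, h2, h3, h4.trans (segment_congr fun x hx => hH x ?_)⟩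
    exact hx.trans (h2.trans ((min_le_left _ _).trans (h.le_writer p)))
  reads := h.reads

theorem crash (h : Inv t w H c) {C : Finset (Fin n)} (hC : c.crashed ⊆ C) :
    Inv t w H { c with crashed := C } where
  loc := h.loc
  le_writer := h.le_writer
  chan_self := h.chan_self
  flow p q hpq := by
    obtain ⟨k, h1, h2, h3, h4⟩ := h.flow p q hpq
    exact ⟨k, h1, h2, fun hp => h3 fun hp' => hp (hC hp'), h4⟩
  reads p q hpq := ⟨(h.reads p q hpq).1,
    fun hp hq => (h.reads p q hpq).2 (fun hp' => hp (hC hp')) fun hq' => hq (hC hq')⟩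

/-- No process overestimates what another one knows. -/
theorem wSync_le (h : Inv t w H c) (p q : Fin n) : (c.loc q).wSync p ≤ (c.loc p).wSync p := by
  rcases eq_or_ne p q with rfl | hpq
  · rfl
  · obtain ⟨k, h1, h2, -⟩ := h.flow p q hpq
    exact h1.trans (h2.trans (min_le_left _ _))

/-- The exchange between two processes is a ping-pong: neither gets ahead by more than one. -/
theorem wSync_le_succ (h : Inv t w H c) {p q : Fin n} (hpq : p ≠ q) :
    (c.loc q).wSync p ≤ (c.loc p).wSync q + 1 := by
  obtain ⟨k, h1, h2, -⟩ := h.flow p q hpq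
  exact h1.trans (h2.trans (min_le_right _ _))

/-- The bit identifies the next message: since at most two messages are in flight from `j` to `i`
and their numbers are consecutive, the one that passes the wait statement is the oldest one. -/
theorem eq_of_mem_inFlight (h : Inv t w H c) {i j : Fin n} (hij : j ≠ i) {b : Bool} {v : V}
    (hm : (b, v) ∈ c.inFlight j i) (hb : b = Nat.bodd ((c.loc i).wSync j + 1)) :
    v = H ((c.loc i).wSync j + 1) ∧ (c.loc i).wSync j + 1 ≤ (c.loc j).wSync j := by
  obtain ⟨k, h1, h2, -, h4⟩ := h.flow j i hij
  have h5 := h.wSync_le_succ hij.symm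
  rw [h4, mem_segment] at hm
  obtain ⟨x, hx1, hx2, hx3⟩ := hm
  obtain ⟨hx3, rfl⟩ := Prod.mk.inj hx3
  have hx : x = (c.loc i).wSync j + 1 := by
    by_contra hne
    obtain rfl : x = (c.loc i).wSync j + 1 + 1 := by omega
    rw [hb, Nat.bodd_succ ((c.loc i).wSync j + 1)] at hx3
    simp at hx3
  subst hx
  exact ⟨rfl, by omega⟩

theorem fits (h : Inv t w H c) {i : Fin n} {a : Action n V} (he : c.Enabled t w i a)
    (hv : ∀ v, a = .invokeWrite v → H ((c.loc i).wSync i + 1) = v) : a.Fits w i H (c.loc i) := by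
  obtain ⟨-, hg, hr⟩ := he
  cases a with
  | invokeWrite v => exact hv v rfl
  | receive j m =>
    rintro rfl
    simpa [h.chan_self] using hr j m rfl
  | handleWrite j b v =>
    have hj : j ≠ i := (h.loc i).waitW_ne _ hg.1
    obtain ⟨h1, h2⟩ := h.eq_of_mem_inFlight hj (mem_inFlight.2 (Or.inr hg.1)) hg.2
    refine ⟨hj, fun he => ⟨?_, h1.symm⟩⟩
    rintro rfl
    have := h.le_writer j
    omega
  | handleRead j sn => exact (h.loc i).waitR_ne _ hg.1
  | _ => trivial

theorem le_writer_exec (h : Inv t w H c) {i : Fin n} {a : Action n V} (he : c.Enabled t w i a) :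
    ((c.loc i).exec i a).wSync i ≤ (c.loc w).wSync w ∨ i = w := by
  by_cases hi : i = w
  · exact Or.inr hi
  left
  by_cases h₂ : ∃ j b v, a = .handleWrite j b v
  · obtain ⟨j, b, v, rfl⟩ := h₂
    have hg := he.2.1
    have hj : j ≠ i := (h.loc i).waitW_ne _ hg.1
    obtain ⟨-, h2⟩ := h.eq_of_mem_inFlight hj (mem_inFlight.2 (Or.inr hg.1)) hg.2
    have := h.le_writer j
    have := h.le_writer i
    rw [LocalState.exec_handleWrite_wSync]
    split_ifs <;> simp only [Function.update_of_ne hj.symm, Function.update_self] <;> omega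
  · push Not at h₂
    rw [LocalState.exec_wSync_of_ne _ h₂]
    · exact h.le_writer i
    · rintro v rfl
      exact hi he.2.1.1

/-- The effect of a block of `i` on the messages in flight to `i`: either nothing changes, or the
next message is processed. -/
theorem inFlight_exec_in (h : Inv t w H c) {i p : Fin n} {a : Action n V}
    (he : c.Enabled t w i a) (hp : p ≠ i) (D : Finset (Fin n)) :
    (((c.loc i).exec i a).wSync p = (c.loc i).wSync p ∧
      (c.exec i a D).inFlight p i = c.inFlight p i) ∨
    (((c.loc i).exec i a).wSync p = (c.loc i).wSync p + 1 ∧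
      c.inFlight p i = (Nat.bodd ((c.loc i).wSync p + 1), H ((c.loc i).wSync p + 1)) ::ₘ
        (c.exec i a D).inFlight p i) := by
  classical
  cases a with
  | receive j m =>
    left
    rcases eq_or_ne p j with rfl | hj
    · obtain ⟨s, hs⟩ := Multiset.exists_cons_of_mem (he.2.2 p m rfl)
      have hc : (c.exec i (.receive p m) D).chan p i = s := by
        rw [Config.exec_chan_in hp, hs, Multiset.erase_cons_head]
      rw [Config.inFlight, Config.inFlight, hc, hs, Config.exec_loc_self]
      cases m with
      | write b v =>
        refine ⟨rfl, ?_⟩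
        rw [Multiset.filterMap_cons_some _ _ _ (rfl : (Msg.write b v).payload = some (b, v))]
        simp [LocalState.exec]
      | read => exact ⟨rfl, by rw [Multiset.filterMap_cons_none _ _ rfl]; rfl⟩
      | proceed =>
        refine ⟨rfl, by rw [Multiset.filterMap_cons_none _ _ rfl]; rfl⟩
    · refine ⟨by cases m <;> rfl, ?_⟩
      rw [Config.inFlight, Config.inFlight, Config.exec_chan_in_of_ne hp (by
        rintro m h; cases h; exact hj rfl), Config.exec_loc_self]
      cases m with
      | write b v => simp [LocalState.exec, hj.symm]
      | _ => rfl
  | handleWrite j b v =>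
    have hg := he.2.1
    obtain ⟨s, hs⟩ := Multiset.exists_cons_of_mem hg.1
    have hji : j ≠ i := (h.loc i).waitW_ne _ hg.1
    rw [LocalState.exec_handleWrite_wSync, Config.inFlight, Config.inFlight,
      Config.exec_chan_in_of_ne hp (by simp), Config.exec_loc_self,
      LocalState.exec_handleWrite_waitW, hs, Multiset.erase_cons_head]
    rcases eq_or_ne p j with rfl | hj
    · right
      obtain ⟨h1, -⟩ := h.eq_of_mem_inFlight hji (mem_inFlight.2 (Or.inr hg.1)) hg.2
      refine ⟨by split_ifs <;> simp, ?_⟩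
      rw [← h1, ← hg.2]
      simp
    · left
      refine ⟨by split_ifs <;> simp [hj, hp], ?_⟩
      simp [hj.symm]
  | invokeWrite v =>
    left
    refine ⟨by simp [LocalState.exec, LocalState.learn, hp], ?_⟩
    exact Config.inFlight_congr (Config.exec_chan_in_of_ne hp (by simp)) (by simp; rfl)
  | _ =>
    left
    exact ⟨rfl, Config.inFlight_congr (Config.exec_chan_in_of_ne hp (by simp)) (by simp; rfl)⟩

theorem flow_exec (h : Inv t w H c) {i : Fin n} {a : Action n V} {C D : Finset (Fin n)}
    (he : c.Enabled t w i a) (hf : a.Fits w i H (c.loc i)) (hC : c.crashed ⊆ C)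
    (hD : D = Finset.univ ∨ i ∈ C) {p q : Fin n} (hpq : p ≠ q) :
    ∃ k, ((c.exec i a D).loc q).wSync p ≤ k ∧
      k ≤ min (((c.exec i a D).loc p).wSync p) (((c.exec i a D).loc p).wSync q + 1) ∧
      (p ∉ C → k = min (((c.exec i a D).loc p).wSync p) (((c.exec i a D).loc p).wSync q + 1)) ∧
      (c.exec i a D).inFlight p q = segment H (((c.exec i a D).loc q).wSync p) k := by
  obtain ⟨k, h1, h2, h3, h4⟩ := h.flow p q hpq
  by_cases hp : p = i
  · subst hp
    have hk := h3 he.1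
    have hqp : q ≠ p := hpq.symm
    have hS := (h.loc p).sends_payload hf hqp
    have m1 := LocalState.wSync_le_exec (i := p) (s := c.loc p) a p
    have m2 := LocalState.wSync_le_exec (i := p) (s := c.loc p) a q
    rw [Config.exec_loc_self, Config.exec_loc_of_ne hqp, Config.inFlight,
      Config.exec_chan_out hqp, Config.exec_loc_of_ne hqp, Multiset.filterMap_add]
    rw [Config.inFlight] at h4
    by_cases hq : q ∈ D
    · refine ⟨_, by omega, le_rfl, fun _ => rfl, ?_⟩
      rw [if_pos hq, add_right_comm, h4, hS, hk, segment_add]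
      · omega
      · omega
    · -- The message is not sent because `p` crashes in the course of this block.
      have hpC : p ∈ C := hD.resolve_left (by rintro rfl; exact hq (Finset.mem_univ _))
      refine ⟨k, h1, by omega, fun h => (h hpC).elim, ?_⟩
      rw [if_neg hq]
      simpa using h4
  by_cases hq : q = i
  · subst hq
    rw [Config.exec_loc_self, Config.exec_loc_of_ne hp]
    rcases h.inFlight_exec_in he hp D with ⟨e1, e2⟩ | ⟨e1, e2⟩
    · rw [e1, e2]
      exact ⟨k, h1, h2, fun h => h3 fun h' => h (hC h'), h4⟩
    · rw [e1]
      have hlt : (c.loc q).wSync p + 1 ≤ k := by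
        by_contra hlt
        rw [segment_of_le _ (by omega), e2] at h4
        exact Multiset.cons_ne_zero h4
      refine ⟨k, hlt, h2, fun h => h3 fun h' => h (hC h'), ?_⟩
      rw [e2, ← segment_add _ (Nat.le_succ _) hlt, Nat.succ_eq_add_one, segment_succ,
        Multiset.singleton_add] at h4
      exact (Multiset.cons_inj_right _).1 h4
  · rw [Config.exec_loc_of_ne hp, Config.exec_loc_of_ne hq]
    refine ⟨k, h1, h2, fun h => h3 fun h' => h (hC h'), ?_⟩
    rw [← h4]
    exact Config.inFlight_congr (Config.exec_chan_of_ne hp hq) (by rw [Config.exec_loc_of_ne hq])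

end Inv

/-! ### READ and PROCEED messages -/

namespace Msg

@[simp] theorem isRead_write (b : Bool) (v : V) : (Msg.write b v).isRead = false := rfl

@[simp] theorem isRead_read : (Msg.read : Msg V).isRead = true := rfl

@[simp] theorem isRead_proceed : (Msg.proceed : Msg V).isRead = false := rfl

@[simp] theorem isProceed_write (b : Bool) (v : V) : (Msg.write b v).isProceed = false := rfl

@[simp] theorem isProceed_read : (Msg.read : Msg V).isProceed = false := rfl

@[simp] theorem isProceed_proceed : (Msg.proceed : Msg V).isProceed = true := rfl

end Msg

namespace LocalState

variable {i : Fin n} {s : LocalState n V} {a : Action n V}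

theorem countP_isRead_sends (ha : a ≠ .invokeRead) (q : Fin n) :
    (s.sends i a q).countP (fun m => m.isRead) = 0 := by
  cases a with
  | invokeRead => exact (ha rfl).elim
  | _ => (simp only [sends, forward]; try split_ifs) <;> simp [← Multiset.cons_zero]

theorem countP_isProceed_sends {q : Fin n} (ha : ∀ sn, a ≠ .handleRead q sn) :
    (s.sends i a q).countP (fun m => m.isProceed) = 0 := by
  cases a with
  | handleRead j sn =>
    have hj : q ≠ j := by rintro rfl; exact ha sn rfl
    simp [sends, hj]
  | _ => (simp only [sends, forward]; try split_ifs) <;> simp [← Multiset.cons_zero]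

theorem exec_rSync_of_ne (h₁ : a ≠ .invokeRead) (h₂ : ∀ j, a ≠ .receive j .proceed) :
    (s.exec i a).rSync = s.rSync := by
  cases a with
  | invokeRead => exact (h₁ rfl).elim
  | receive j m =>
    cases m with
    | proceed => exact (h₂ j rfl).elim
    | _ => rfl
  | handleWrite j b v => exact exec_handleWrite_rSync j b v
  | _ => rfl

theorem exec_waitR_of_ne (h₁ : ∀ j, a ≠ .receive j .read) (h₂ : ∀ j sn, a ≠ .handleRead j sn) :
    (s.exec i a).waitR = s.waitR := by
  cases a with
  | handleRead j sn => exact (h₂ j sn rfl).elim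
  | receive j m =>
    cases m with
    | read => exact (h₁ j rfl).elim
    | _ => rfl
  | handleWrite j b v => exact exec_handleWrite_waitR j b v
  | _ => rfl

end LocalState

namespace Inv

variable {t : ℕ} {w : Fin n} {H : ℕ → V} {c : Config n V}

theorem reads_exec_reader {p q : Fin n} {a : Action n V} (D : Finset (Fin n))
    (he : c.Enabled t w p a) (hf : a.Fits w p H (c.loc p)) (hpq : p ≠ q) :
    (c.exec p a D).pendingReads p q + ((c.exec p a D).loc p).rSync q + (c.loc p).rSync p ≤
        c.pendingReads p q + (c.loc p).rSync q + ((c.exec p a D).loc p).rSync p ∧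
      (D = Finset.univ →
        (c.exec p a D).pendingReads p q + ((c.exec p a D).loc p).rSync q + (c.loc p).rSync p =
          c.pendingReads p q + (c.loc p).rSync q + ((c.exec p a D).loc p).rSync p) := by
  classical
  have hqp := hpq.symm
  simp only [Config.pendingReads, Config.exec_loc_self, Config.exec_loc_of_ne hqp,
    Config.exec_chan_out hqp]
  by_cases h₁ : a = .invokeRead
  · subst h₁
    rw [Config.exec_chan_in_of_ne hqp (by simp)]
    simp only [LocalState.exec, LocalState.sends, Function.update_self, Function.update_of_ne hqp,
      if_pos hqp, Multiset.countP_add]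
    constructor
    · split_ifs <;> simp [← Multiset.cons_zero, Multiset.countP_cons]
      omega
    · rintro rfl
      simp [← Multiset.cons_zero, Multiset.countP_cons]
      omega
  have hout : Multiset.countP (fun m => m.isRead = true)
      (c.chan p q + if q ∈ D then (c.loc p).sends p a q else 0) =
        Multiset.countP (fun m => m.isRead = true) (c.chan p q) := by
    rw [Multiset.countP_add]
    split_ifs
    · rw [LocalState.countP_isRead_sends h₁, add_zero]
    · simp
  rw [hout]
  suffices h : (c.chan q p).countP (fun m => m.isProceed = true) + (c.loc p).rSync q +
      ((c.loc p).exec p a).rSync p =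
      ((c.exec p a D).chan q p).countP (fun m => m.isProceed = true) +
        ((c.loc p).exec p a).rSync q + (c.loc p).rSync p by
    exact ⟨by omega, fun _ => by omega⟩
  by_cases h₂ : ∃ m, a = .receive q m
  · obtain ⟨m, rfl⟩ := h₂
    obtain ⟨s, hs⟩ := Multiset.exists_cons_of_mem (he.2.2 q m rfl)
    rw [Config.exec_chan_in hqp, hs, Multiset.erase_cons_head]
    cases m <;> simp [Multiset.countP_cons, LocalState.exec, hpq]
    omega
  · push Not at h₂
    rw [Config.exec_chan_in_of_ne hqp h₂]
    cases a with
    | receive j m =>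
      have hj : q ≠ j := by rintro rfl; exact h₂ m rfl
      have hj' : p ≠ j := hf.symm
      cases m <;> simp [LocalState.exec, hj, hj']
    | _ => rw [LocalState.exec_rSync_of_ne h₁ (by simp)]

theorem reads_exec_helper {p q : Fin n} {a : Action n V} (D : Finset (Fin n))
    (he : c.Enabled t w q a) (hpq : p ≠ q) :
    (c.exec q a D).pendingReads p q ≤ c.pendingReads p q ∧
      (D = Finset.univ → (c.exec q a D).pendingReads p q = c.pendingReads p q) := by
  classical
  simp only [Config.pendingReads, Config.exec_loc_self, Config.exec_chan_out hpq,
    Multiset.countP_add]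
  by_cases h₁ : ∃ sn, a = .handleRead p sn
  · obtain ⟨sn, rfl⟩ := h₁
    obtain ⟨s, hs⟩ := Multiset.exists_cons_of_mem he.2.1.1
    rw [Config.exec_chan_in_of_ne hpq (by simp)]
    simp only [LocalState.exec, hs, LocalState.sends, Multiset.erase_cons_head, if_true]
    constructor
    · split_ifs <;> simp [← Multiset.cons_zero, Multiset.countP_cons]
      omega
    · rintro rfl
      simp [← Multiset.cons_zero, Multiset.countP_cons]
      omega
  push Not at h₁
  have hout : Multiset.countP (fun m => m.isProceed = true)
      (if p ∈ D then (c.loc q).sends q a p else 0) = 0 := by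
    split_ifs
    · exact LocalState.countP_isProceed_sends h₁
    · simp
  rw [hout]
  suffices h : (c.chan p q).countP (fun m => m.isRead = true) +
      (c.loc q).waitR.countP (fun e => e.1 = p) =
      ((c.exec q a D).chan p q).countP (fun m => m.isRead = true) +
        ((c.loc q).exec q a).waitR.countP (fun e => e.1 = p) by
    exact ⟨by omega, fun _ => by omega⟩
  by_cases h₂ : ∃ m, a = .receive p m
  · obtain ⟨m, rfl⟩ := h₂
    obtain ⟨s, hs⟩ := Multiset.exists_cons_of_mem (he.2.2 p m rfl)
    rw [Config.exec_chan_in hpq, hs, Multiset.erase_cons_head]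
    cases m <;> simp [Multiset.countP_cons, LocalState.exec]
    omega
  · push Not at h₂
    rw [Config.exec_chan_in_of_ne hpq h₂]
    cases a with
    | receive j m =>
      have hj : j ≠ p := by rintro rfl; exact h₂ m rfl
      cases m <;> simp [LocalState.exec, hj]
    | handleRead j sn =>
      have hj : j ≠ p := by rintro rfl; exact h₁ sn rfl
      obtain ⟨s, hs⟩ := Multiset.exists_cons_of_mem he.2.1.1
      simp [LocalState.exec, hs, hj]
    | _ => rw [LocalState.exec_waitR_of_ne (by simp) (by simp)]

theorem exec (h : Inv t w H c) {i : Fin n} {a : Action n V} {C D : Finset (Fin n)}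
    (he : c.Enabled t w i a) (hv : ∀ v, a = .invokeWrite v → H ((c.loc i).wSync i + 1) = v)
    (hC : c.crashed ⊆ C) (hD : D = Finset.univ ∨ i ∈ C) :
    Inv t w H { c.exec i a D with crashed := C } where
  loc p := by
    rcases eq_or_ne p i with rfl | hp
    · simpa using (h.loc p).exec he.2.1 (h.fits he hv)
    · simpa [Config.exec_loc_of_ne hp] using h.loc p
  le_writer p := by
    have hw : (c.loc w).wSync w ≤ ((c.exec i a D).loc w).wSync w := by
      rcases eq_or_ne w i with rfl | hw
      · simpa using LocalState.wSync_le_exec a w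
      · rw [Config.exec_loc_of_ne hw]
    rcases eq_or_ne p i with rfl | hp
    · rcases h.le_writer_exec he with h' | rfl
      · exact (by simpa using h' : ((c.exec p a D).loc p).wSync p ≤ _).trans hw
      · exact le_rfl
    · refine le_trans ?_ hw
      simpa [Config.exec_loc_of_ne hp] using h.le_writer p
  chan_self p := by
    rcases eq_or_ne p i with rfl | hp
    · exact Config.exec_chan_self (h.chan_self p) (h.fits he hv).sends_self
    · exact (Config.exec_chan_of_ne hp hp).trans (h.chan_self p)
  flow p q hpq := h.flow_exec he (h.fits he hv) hC hD hpq
  reads p q hpq := by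
    obtain ⟨h1, h2⟩ := h.reads p q hpq
    change (c.exec i a D).pendingReads p q + ((c.exec i a D).loc p).rSync q ≤
        ((c.exec i a D).loc p).rSync p ∧ (p ∉ C → q ∉ C →
      (c.exec i a D).pendingReads p q + ((c.exec i a D).loc p).rSync q =
        ((c.exec i a D).loc p).rSync p)
    have h2' : p ∉ C → q ∉ C → _ := fun hp hq => h2 (fun h => hp (hC h)) fun h => hq (hC h)
    by_cases hp : p = i
    · subst hp
      obtain ⟨h3, h4⟩ := reads_exec_reader D he (h.fits he hv) hpq
      refine ⟨by omega, fun hp hq => ?_⟩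
      have h5 := h4 (hD.resolve_right hp)
      have h6 := h2' hp hq
      omega
    by_cases hq : q = i
    · subst hq
      obtain ⟨h3, h4⟩ := reads_exec_helper D he hpq
      rw [Config.exec_loc_of_ne hpq]
      refine ⟨by omega, fun hp hq => ?_⟩
      have h5 := h4 (hD.resolve_right hq)
      have h6 := h2' hp hq
      omega
    · simp only [Config.pendingReads, Config.exec_loc_of_ne hp, Config.exec_loc_of_ne hq,
        Config.exec_chan_of_ne hp hq, Config.exec_chan_of_ne hq hp]
      exact ⟨h1, h2'⟩

end Inv

/-! ### Runs -/

theorem Step.eq_or_exec {t : ℕ} {w : Fin n} {c c' : Config n V} {e : Event n V}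
    (h : Step t w c e c') :
    (e.action = none ∧ ∃ C, c.crashed ⊆ C ∧ c' = { c with crashed := C }) ∨
    ∃ i a D C, e.action = some (i, a) ∧ c.Enabled t w i a ∧ c.crashed ⊆ C ∧
      (D = Finset.univ ∨ i ∈ C) ∧ c' = { c.exec i a D with crashed := C } := by
  cases e with
  | tick => exact Or.inl ⟨rfl, c.crashed, subset_rfl, h⟩
  | step i a => exact Or.inr ⟨i, a, _, c.crashed, rfl, h.1, subset_rfl, Or.inl rfl, h.2⟩
  | crash i => exact Or.inl ⟨rfl, _, Finset.subset_insert _ _, h.2⟩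
  | crashIn i a D =>
    exact Or.inr ⟨i, a, D, _, rfl, h.1, Finset.subset_insert _ _,
      Or.inr (Finset.mem_insert_self _ _), h.2⟩

namespace Run

variable {t : ℕ} {w : Fin n} {v₀ : V} (r : Run n t w v₀)

theorem crashed_mono {τ σ : ℕ} (h : τ ≤ σ) : (r.cfg τ).crashed ⊆ (r.cfg σ).crashed := by
  induction σ, h using Nat.le_induction with
  | base => rfl
  | succ σ _ ih =>
    refine ih.trans ?_
    rcases (r.step σ).eq_or_exec with ⟨-, C, hC, h⟩ | ⟨i, a, D, C, -, -, hC, -, h⟩ <;>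
      rw [h] <;> exact hC

variable {r}

theorem enabled {τ : ℕ} {i : Fin n} {a : Action n V} (h : (r.ev τ).action = some (i, a)) :
    (r.cfg τ).Enabled t w i a := by
  rcases (r.step τ).eq_or_exec with ⟨h', -⟩ | ⟨i, a, D, C, h', he, -⟩
  · simp [h] at h'
  · rw [h] at h'
    cases h'
    exact he

theorem loc_succ {τ : ℕ} {i : Fin n} {a : Action n V} (h : (r.ev τ).action = some (i, a)) :
    (r.cfg (τ + 1)).loc i = ((r.cfg τ).loc i).exec i a := by
  rcases (r.step τ).eq_or_exec with ⟨h', -⟩ | ⟨i, a, D, C, h', he, -, -, hc⟩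
  · simp [h] at h'
  · rw [h] at h'
    cases h'
    rw [hc]
    exact Config.exec_loc_self (D := D)

theorem loc_succ_of_ne {τ : ℕ} {i : Fin n} (h : ∀ a, (r.ev τ).action ≠ some (i, a)) :
    (r.cfg (τ + 1)).loc i = (r.cfg τ).loc i := by
  rcases (r.step τ).eq_or_exec with ⟨-, C, -, hc⟩ | ⟨j, a, D, C, h', he, -, -, hc⟩
  · rw [hc]
  · have hij : i ≠ j := by rintro rfl; exact h a h'
    rw [hc]
    exact Config.exec_loc_of_ne (D := D) hij

/-- A process either does nothing in an event or executes a block. -/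
theorem loc_succ_or (r : Run n t w v₀) (τ : ℕ) (i : Fin n) :
    (∃ a, (r.ev τ).action = some (i, a)) ∨ (r.cfg (τ + 1)).loc i = (r.cfg τ).loc i := by
  by_cases h : ∃ a, (r.ev τ).action = some (i, a)
  · exact Or.inl h
  · push Not at h
    exact Or.inr (loc_succ_of_ne h)

theorem wSync_mono (r : Run n t w v₀) (i j : Fin n) :
    Monotone fun τ => ((r.cfg τ).loc i).wSync j := by
  refine monotone_nat_of_le_succ fun τ => ?_
  rcases r.loc_succ_or τ i with ⟨a, ha⟩ | h
  · change _ ≤ ((r.cfg (τ + 1)).loc i).wSync j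
    rw [loc_succ ha]
    exact LocalState.wSync_le_exec a j
  · exact (congrArg (fun s => s.wSync j) h).ge

/-- A message remains in the channel until it is received. -/
theorem mem_chan_succ {τ : ℕ} {p q : Fin n} {m : Msg V} (hm : m ∈ (r.cfg τ).chan p q)
    (h : (r.ev τ).action ≠ some (q, .receive p m)) : m ∈ (r.cfg (τ + 1)).chan p q := by
  classical
  rcases (r.step τ).eq_or_exec with ⟨-, C, -, hc⟩ | ⟨i, a, D, C, h', he, -, -, hc⟩
  · rw [hc]
    exact hm
  · rw [hc]
    change m ∈ ((r.cfg τ).exec i a D).chan p q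
    simp only [Config.exec, Multiset.mem_add]
    left
    cases a with
    | receive j m' =>
      simp only
      split_ifs with hpq
      · obtain ⟨rfl, rfl⟩ := hpq
        refine (Multiset.mem_erase_of_ne ?_).2 hm
        rintro rfl
        exact h h'
      · exact hm
    | _ => exact hm

theorem mem_chan_of_mem_sends {τ : ℕ} {p q : Fin n} {a : Action n V} {m : Msg V}
    (h : (r.ev τ).action = some (p, a)) (hp : p ∉ (r.cfg (τ + 1)).crashed)
    (hm : m ∈ ((r.cfg τ).loc p).sends p a q) : m ∈ (r.cfg (τ + 1)).chan p q := by
  rcases (r.step τ).eq_or_exec with ⟨h', -⟩ | ⟨i, a, D, C, h', he, -, hD, hc⟩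
  · simp [h] at h'
  · rw [h] at h'
    cases h'
    rw [hc] at hp ⊢
    have hD := hD.resolve_right hp
    change m ∈ ((r.cfg τ).exec p a D).chan p q
    subst hD
    simp only [Config.exec, Multiset.mem_add]
    right
    simpa using hm

/-- The numbering of the values can be read off from the history of the writer. -/
theorem inv (r : Run n t w v₀) (τ : ℕ) :
    Inv t w ((r.cfg τ).loc w).history (r.cfg τ) := by
  suffices h : ∃ H, Inv t w H (r.cfg τ) by
    obtain ⟨H, h⟩ := h
    exact h.congr fun x hx => ((h.loc w).history_eq x hx).symm
  induction τ with
  | zero => exact ⟨fun _ => v₀, by rw [r.cfg_zero]; exact Inv.start t w rfl⟩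
  | succ τ ih =>
    obtain ⟨H, h⟩ := ih
    rcases (r.step τ).eq_or_exec with ⟨-, C, hC, hc⟩ | ⟨i, a, D, C, h', he, hC, hD, hc⟩
    · exact ⟨H, by rw [hc]; exact h.crash hC⟩
    · rw [hc]
      by_cases ha : ∃ v, a = .invokeWrite v
      · obtain ⟨v, rfl⟩ := ha
        have hi : i = w := he.2.1.1
        -- The value just written receives the first number that is not in use.
        refine ⟨Function.update H ((r.cfg τ |>.loc w).wSync w + 1) v,
          (h.congr fun x hx => ?_).exec he (fun u hu => ?_) hC hD⟩
        · rw [Function.update_of_ne (by omega)]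
        · cases hu
          rw [hi, Function.update_self]
      · push Not at ha
        exact ⟨H, h.exec he (fun v hv => (ha v hv).elim) hC hD⟩

/-! ### The written values -/

theorem isWriteOf_iff {τ : ℕ} {v : V} :
    r.IsWriteOf τ v ↔ (r.ev τ).action = some (w, .invokeWrite v) := by
  refine ⟨fun ⟨i, hi⟩ => ?_, fun h => ⟨w, h⟩⟩
  have : i = w := (enabled hi).2.1.1
  rwa [this] at hi

theorem isOp_of_isWriteOf {τ : ℕ} {v : V} (h : r.IsWriteOf τ v) : r.IsOp τ :=
  ⟨w, _, isWriteOf_iff.1 h, .write v⟩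

theorem wSync_succ_of_isWriteOf {τ : ℕ} {v : V} (h : r.IsWriteOf τ v) :
    ((r.cfg (τ + 1)).loc w).wSync w = ((r.cfg τ).loc w).wSync w + 1 ∧
      ((r.cfg (τ + 1)).loc w).history =
        Function.update ((r.cfg τ).loc w).history (((r.cfg τ).loc w).wSync w + 1) v := by
  rw [loc_succ (isWriteOf_iff.1 h)]
  simp [LocalState.exec, LocalState.learn]

/-- The writer learns no value from the other processes. -/
theorem wSync_succ_of_not_isWrite {τ : ℕ} (h : ¬ r.IsWrite τ) :
    ((r.cfg (τ + 1)).loc w).wSync w = ((r.cfg τ).loc w).wSync w ∧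
      ((r.cfg (τ + 1)).loc w).history = ((r.cfg τ).loc w).history := by
  rcases r.loc_succ_or τ w with ⟨a, ha⟩ | h'
  · have h₁ : ∀ v, a ≠ .invokeWrite v := by
      rintro v rfl
      exact h ⟨v, w, ha⟩
    rw [loc_succ ha]
    by_cases h₂ : ∃ j b v, a = .handleWrite j b v
    · obtain ⟨j, b, v, rfl⟩ := h₂
      obtain ⟨hj, hl⟩ := (r.inv τ).fits (enabled ha) (by simp)
      have hne : ((r.cfg τ).loc w).wSync j ≠ ((r.cfg τ).loc w).wSync w := fun he => (hl he).1 rfl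
      rw [LocalState.exec_handleWrite_wSync, LocalState.exec_handleWrite_history, if_neg hne,
        if_neg hne, Function.update_of_ne hj.symm]
      exact ⟨rfl, rfl⟩
    · push Not at h₂
      rw [LocalState.exec_wSync_of_ne h₁ h₂, LocalState.exec_history_of_ne h₁ h₂]
      exact ⟨rfl, rfl⟩
  · rw [h']
    exact ⟨rfl, rfl⟩

theorem ncard_isWrite (r : Run n t w v₀) (τ : ℕ) :
    {σ | σ < τ ∧ r.IsWrite σ}.ncard = ((r.cfg τ).loc w).wSync w := by
  induction τ with
  | zero => simp [r.cfg_zero, Config.start]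
  | succ τ ih =>
    have hfin : {σ | σ < τ ∧ r.IsWrite σ}.Finite := (Set.finite_lt_nat τ).subset fun σ h => h.1
    by_cases h : r.IsWrite τ
    · have : {σ | σ < τ + 1 ∧ r.IsWrite σ} = insert τ {σ | σ < τ ∧ r.IsWrite σ} := by
        ext σ
        simp only [Set.mem_ofPred_eq, Set.mem_insert_iff, Nat.lt_succ_iff_lt_or_eq]
        constructor
        · rintro ⟨h1 | h1, h2⟩
          exacts [Or.inr ⟨h1, h2⟩, Or.inl h1]
        · rintro (rfl | ⟨h1, h2⟩)
          exacts [⟨Or.inr rfl, h⟩, ⟨Or.inl h1, h2⟩]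
      obtain ⟨v, hv⟩ := h
      rw [this, Set.ncard_insert_of_notMem (by simp) hfin, ih, (wSync_succ_of_isWriteOf hv).1]
    · have : {σ | σ < τ + 1 ∧ r.IsWrite σ} = {σ | σ < τ ∧ r.IsWrite σ} := by
        ext σ
        simp only [Set.mem_ofPred_eq, Nat.lt_succ_iff_lt_or_eq]
        constructor
        · rintro ⟨h1 | rfl, h2⟩
          exacts [⟨h1, h2⟩, (h h2).elim]
        · rintro ⟨h1, h2⟩
          exact ⟨Or.inl h1, h2⟩
      rw [this, ih, (wSync_succ_of_not_isWrite h).1]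

theorem isNthWrite_iff {x τ : ℕ} {v : V} :
    r.IsNthWrite x τ v ↔ r.IsWriteOf τ v ∧ x = ((r.cfg τ).loc w).wSync w + 1 := by
  refine and_congr_right fun h => ?_
  rw [← (wSync_succ_of_isWriteOf h).1, ← r.ncard_isWrite, eq_comm]
  simp only [Nat.lt_succ_iff]

theorem history_zero (r : Run n t w v₀) (τ : ℕ) : ((r.cfg τ).loc w).history 0 = v₀ := by
  induction τ with
  | zero => simp [r.cfg_zero, Config.start]
  | succ τ ih =>
    by_cases h : r.IsWrite τ
    · obtain ⟨v, hv⟩ := h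
      rw [(wSync_succ_of_isWriteOf hv).2, Function.update_of_ne (by omega), ih]
    · rw [(wSync_succ_of_not_isWrite h).2, ih]

theorem exists_isNthWrite (r : Run n t w v₀) {τ x : ℕ} (hx : x ≠ 0)
    (h : x ≤ ((r.cfg τ).loc w).wSync w) :
    ∃ b, r.IsNthWrite x b (((r.cfg τ).loc w).history x) := by
  induction τ with
  | zero =>
    simp [r.cfg_zero, Config.start] at h
    exact (hx h).elim
  | succ τ ih =>
    by_cases hw : r.IsWrite τ
    · obtain ⟨v, hv⟩ := hw
      obtain ⟨h1, h2⟩ := wSync_succ_of_isWriteOf hv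
      rw [h1] at h
      rw [h2]
      rcases h.lt_or_eq with h | rfl
      · rw [Function.update_of_ne (by omega)]
        exact ih (by omega)
      · rw [Function.update_self]
        exact ⟨τ, isNthWrite_iff.2 ⟨hv, rfl⟩⟩
    · obtain ⟨h1, h2⟩ := wSync_succ_of_not_isWrite hw
      rw [h1] at h
      rw [h2]
      exact ih h

theorem IsNthWrite.lt_of_lt {a b x y : ℕ} {u v : V} (ha : r.IsNthWrite x a u)
    (hb : r.IsNthWrite y b v) (h : a < b) : x < y := by
  obtain ⟨ha, hx⟩ := isNthWrite_iff.1 ha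
  obtain ⟨-, hy⟩ := isNthWrite_iff.1 hb
  have := (wSync_succ_of_isWriteOf ha).1
  have := r.wSync_mono w w (show a + 1 ≤ b from h)
  simp only at this
  omega

theorem IsNthWrite.le_of_le {a b x y : ℕ} {u v : V} (ha : r.IsNthWrite x a u)
    (hb : r.IsNthWrite y b v) (h : x ≤ y) : a ≤ b := by
  by_contra! hlt
  have := hb.lt_of_lt ha hlt
  omega

/-! ### The progress of an operation -/

theorem pc_succ {τ : ℕ} {i : Fin n} (hr : ¬ r.ReturnBy τ i)
    (hpc : ((r.cfg τ).loc i).pc ≠ .idle) :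
    ((r.cfg (τ + 1)).loc i).pc = ((r.cfg τ).loc i).pc ∨
      (r.ev τ).action = some (i, .confirmRead) := by
  rcases r.loc_succ_or τ i with ⟨a, ha⟩ | h
  · have hg := (enabled ha).2.1
    rw [loc_succ ha]
    cases a with
    | invokeWrite v => exact (hpc hg.2).elim
    | invokeRead => exact (hpc hg).elim
    | invokeDirectRead => exact (hpc hg.2).elim
    | returnWrite => exact (hr ⟨_, ha, .write⟩).elim
    | returnRead sn => exact (hr ⟨_, ha, .read sn⟩).elim
    | confirmRead => exact Or.inr ha
    | receive j m => left; cases m <;> rfl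
    | handleWrite j b v => exact Or.inl (LocalState.exec_handleWrite_pc j b v)
    | handleRead j sn => exact Or.inl rfl
  · exact Or.inl (by rw [h])

/-- Only a process in the first wait statement of a read can move without returning. -/
theorem pc_eq_of_not_return {τ σ : ℕ} {i : Fin n} (hτ : τ ≤ σ)
    (hidle : ((r.cfg τ).loc i).pc ≠ .idle) (hread : ∀ x, ((r.cfg τ).loc i).pc ≠ .reading x)
    (hr : ∀ ρ, τ ≤ ρ → ρ < σ → ¬ r.ReturnBy ρ i) :
    ((r.cfg σ).loc i).pc = ((r.cfg τ).loc i).pc := by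
  induction σ, hτ using Nat.le_induction with
  | base => rfl
  | succ σ hσ ih =>
    have ih := ih fun ρ h h' => hr ρ h (by omega)
    rw [← ih] at hidle hread ⊢
    refine (pc_succ (hr σ hσ (by omega)) hidle).resolve_right fun h => ?_
    obtain ⟨x, hx, -⟩ := (enabled h).2.1
    exact hread x hx

theorem pc_of_invokeWrite {τ σ : ℕ} {i : Fin n} {v : V} (hτ : τ < σ)
    (h : (r.ev τ).action = some (i, .invokeWrite v))
    (hr : ∀ ρ, τ < ρ → ρ < σ → ¬ r.ReturnBy ρ i) :
    ((r.cfg σ).loc i).pc = .writing (((r.cfg τ).loc i).wSync i + 1) := by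
  have h' : ((r.cfg (τ + 1)).loc i).pc = .writing (((r.cfg τ).loc i).wSync i + 1) := by
    rw [loc_succ h]
    rfl
  rw [← h']
  exact pc_eq_of_not_return hτ (by rw [h']; nofun) (by rw [h']; nofun) hr

theorem pc_of_invokeDirectRead {τ σ : ℕ} {i : Fin n} (hτ : τ < σ)
    (h : (r.ev τ).action = some (i, .invokeDirectRead))
    (hr : ∀ ρ, τ < ρ → ρ < σ → ¬ r.ReturnBy ρ i) :
    ((r.cfg σ).loc i).pc = .direct (((r.cfg τ).loc i).wSync i) := by
  have h' : ((r.cfg (τ + 1)).loc i).pc = .direct (((r.cfg τ).loc i).wSync i) := by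
    rw [loc_succ h]
    rfl
  rw [← h']
  exact pc_eq_of_not_return hτ (by rw [h']; nofun) (by rw [h']; nofun) hr

/-! ### Values known to a quorum -/

/-- At time `τ`, the value number `x` is known to at least `n - t` processes. -/
def Known (r : Run n t w v₀) (x τ : ℕ) : Prop :=
  n - t ≤ (Finset.univ.filter fun j => x ≤ ((r.cfg τ).loc j).wSync j).card

theorem Known.mono {x τ σ : ℕ} (h : r.Known x τ) (hτ : τ ≤ σ) : r.Known x σ := by
  refine h.trans (Finset.card_le_card fun j hj => ?_)
  rw [Finset.mem_filter] at hj ⊢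
  exact ⟨hj.1, hj.2.trans (r.wSync_mono j j hτ)⟩

/-- What a process believes about others is true: it suffices that one process knows of `n - t`
processes that they know the value. -/
theorem known_of_card {x τ : ℕ} {i : Fin n}
    (h : n - t ≤ (Finset.univ.filter fun j => x ≤ ((r.cfg τ).loc i).wSync j).card) :
    r.Known x τ := by
  refine h.trans (Finset.card_le_card fun j hj => ?_)
  rw [Finset.mem_filter] at hj ⊢
  exact ⟨hj.1, hj.2.trans ((r.inv τ).wSync_le j i)⟩

/-- Two quorums meet. -/
theorem exists_mem_of_card (ht : 2 * t < n) {P Q : Fin n → Prop} [DecidablePred P]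
    [DecidablePred Q] (hP : n - t ≤ (Finset.univ.filter P).card)
    (hQ : n - t ≤ (Finset.univ.filter Q).card) : ∃ j, P j ∧ Q j := by
  have h : (Finset.univ : Finset (Fin n)).card <
      (Finset.univ.filter P).card + (Finset.univ.filter Q).card := by
    rw [Finset.card_univ, Fintype.card_fin]
    omega
  obtain ⟨j, hj⟩ := Finset.inter_nonempty_of_card_lt_card_add_card (Finset.subset_univ _)
    (Finset.subset_univ _) h
  simp only [Finset.mem_inter, Finset.mem_filter, Finset.mem_univ, true_and] at hj
  exact ⟨j, hj⟩

/-- A READ message of `i` to `j` has not been received, or its handler is waiting until `i` knows the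
value number `x` at least, or `j` knows that `i` knows this value. This is what follows from a READ
message that was sent when `j` knew the value number `x`. -/
def Served (c : Config n V) (x : ℕ) (i j : Fin n) : Prop :=
  .read ∈ c.chan i j ∨ (∃ sn, x ≤ sn ∧ (i, sn) ∈ (c.loc j).waitR) ∨ x ≤ (c.loc j).wSync i

theorem Served.succ {x τ : ℕ} {i j : Fin n} (h : Served (r.cfg τ) x i j)
    (hj : x ≤ ((r.cfg τ).loc j).wSync j) : Served (r.cfg (τ + 1)) x i j := by
  classical
  rcases h with h | ⟨sn, hsn, h⟩ | h
  · by_cases ha : (r.ev τ).action = some (j, .receive i .read)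
    · right
      left
      rw [loc_succ ha]
      exact ⟨_, hj, Multiset.mem_cons_self _ _⟩
    · exact Or.inl (mem_chan_succ h ha)
  · rcases r.loc_succ_or τ j with ⟨a, ha⟩ | h'
    · by_cases hai : a = .handleRead i sn
      · subst hai
        exact Or.inr (Or.inr ((hsn.trans (enabled ha).2.1.2).trans
          (r.wSync_mono j i (Nat.le_succ τ))))
      · right
        left
        refine ⟨sn, hsn, ?_⟩
        rw [loc_succ ha]
        by_cases h₁ : ∃ k, a = .receive k .read
        · obtain ⟨k, rfl⟩ := h₁
          exact Multiset.mem_cons_of_mem h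
        by_cases h₂ : ∃ k sn', a = .handleRead k sn'
        · obtain ⟨k, sn', rfl⟩ := h₂
          refine (Multiset.mem_erase_of_ne ?_).2 h
          rintro h'
          cases h'
          exact hai rfl
        push Not at h₁ h₂
        rwa [LocalState.exec_waitR_of_ne h₁ h₂]
    · right
      left
      rw [h']
      exact ⟨sn, hsn, h⟩
  · exact Or.inr (Or.inr (h.trans (r.wSync_mono j i (Nat.le_succ τ))))

/-- The quorum that knew the value number `x` at the invocation of a read meets the quorum that has
answered before the end of the first wait statement, and an answer from a process that knew the
value number `x` when the read started arrives only after the reader has learnt that value. -/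
theorem progress_of_invokeRead (ht : 2 * t < n) {τ σ x : ℕ} {i : Fin n} (hx : r.Known x τ)
    (hτ : τ < σ) (h : (r.ev τ).action = some (i, .invokeRead))
    (hr : ∀ ρ, τ < ρ → ρ < σ → ¬ r.ReturnBy ρ i) :
    i ∈ (r.cfg σ).crashed ∨
      ((∃ k, ((r.cfg σ).loc i).pc = .reading k) ∧
        ∀ j ≠ i, x ≤ ((r.cfg τ).loc j).wSync j → Served (r.cfg σ) x i j) ∨
      ∃ y, ((r.cfg σ).loc i).pc = .confirming y ∧ x ≤ y := by
  induction σ, Nat.succ_le_of_lt hτ using Nat.le_induction with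
  | base =>
    by_cases hc : i ∈ (r.cfg (τ + 1)).crashed
    · exact Or.inl hc
    refine Or.inr (Or.inl ⟨⟨_, by rw [Nat.succ_eq_add_one, loc_succ h]; rfl⟩,
      fun j hj _ => Or.inl ?_⟩)
    refine mem_chan_of_mem_sends h hc ?_
    simp [LocalState.sends, hj]
  | succ σ hσ ih =>
    have hret := hr σ hσ (by omega)
    rcases ih hσ fun ρ h h' => hr ρ h (by omega) with hc | ⟨⟨k, hk⟩, hs⟩ | ⟨y, hy, hxy⟩
    · exact Or.inl (r.crashed_mono (Nat.le_succ σ) hc)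
    · right
      rcases pc_succ hret (by rw [hk]; nofun) with h' | h'
      · left
        refine ⟨⟨k, h'.trans hk⟩, fun j hj hxj => (hs j hj hxj).succ (hxj.trans ?_)⟩
        exact r.wSync_mono j j (by omega : τ ≤ σ)
      · right
        refine ⟨((r.cfg σ).loc i).wSync i, by rw [loc_succ h']; rfl, ?_⟩
        obtain ⟨k', hk', hq⟩ := (enabled h').2.1
        have hinv := r.inv σ
        obtain ⟨j, hj, hj'⟩ := exists_mem_of_card ht hx hq
        rcases eq_or_ne j i with rfl | hji
        · exact hj.trans (r.wSync_mono j j (by omega : τ ≤ σ))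
        -- All the READ messages of `i` to `j` have been answered, so none is pending.
        have hle := (hinv.reads i j hji.symm).1
        rw [hj', ← (hinv.loc i).reading k' hk'] at hle
        have h0 : (r.cfg σ).pendingReads i j = 0 := by omega
        simp only [Config.pendingReads, Nat.add_eq_zero_iff, Multiset.countP_eq_zero] at h0
        rcases hs j hji hj with h | ⟨sn, -, h⟩ | h
        · exact (h0.1.1 _ h rfl).elim
        · exact (h0.1.2 _ h rfl).elim
        · exact h.trans (hinv.wSync_le i j)
    · right
      right
      refine ⟨y, ?_, hxy⟩
      rw [← hy]
      refine (pc_succ hret (by rw [hy]; nofun)).resolve_right fun h' => ?_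
      obtain ⟨k', hk', -⟩ := (enabled h').2.1
      rw [hy] at hk'
      cases hk'

theorem known_zero (r : Run n t w v₀) (τ : ℕ) : r.Known 0 τ := by simp [Known]

/-! ### Terminated operations -/

theorem eq_of_action {τ : ℕ} {i j : Fin n} {a b : Action n V}
    (h : (r.ev τ).action = some (i, a)) (h' : (r.ev τ).action = some (j, b)) : i = j ∧ a = b := by
  rw [h] at h'
  cases h'
  exact ⟨rfl, rfl⟩

theorem TerminatesAt.unique {τ σ σ' : ℕ} (h : r.TerminatesAt τ σ) (h' : r.TerminatesAt τ σ') :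
    σ = σ' := by
  obtain ⟨i, ⟨a, ha, -⟩, h1, h2, h3⟩ := h
  obtain ⟨j, ⟨b, hb, -⟩, h4, h5, h6⟩ := h'
  obtain ⟨rfl, rfl⟩ := eq_of_action ha hb
  rcases lt_trichotomy σ σ' with h | h | h
  exacts [(h6 σ h1 h h2).elim, h, (h3 σ' h4 h h5).elim]

theorem TerminatesAt.lt {τ σ : ℕ} (h : r.TerminatesAt τ σ) : τ < σ := by
  obtain ⟨i, -, h, -⟩ := h
  exact h

/-- A written value is known to a quorum when the write returns. -/
theorem known_of_isNthWrite {x τ σ : ℕ} {v : V} (h : r.IsNthWrite x τ v)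
    (hσ : r.TerminatesAt τ σ) : r.Known x σ := by
  obtain ⟨hv, hx⟩ := isNthWrite_iff.1 h
  rw [isWriteOf_iff] at hv
  obtain ⟨i, ⟨a, ha, -⟩, h1, ⟨b, hb, hb'⟩, h3⟩ := hσ
  obtain ⟨rfl, rfl⟩ := eq_of_action ha hv
  have hpc := pc_of_invokeWrite h1 ha h3
  have hg := (enabled hb).2.1
  cases hb' with
  | write =>
    obtain ⟨k, hk, hq⟩ := hg
    rw [hpc] at hk
    cases hk
    refine known_of_card (i := i) (hq.trans (Finset.card_le_card fun j hj => ?_))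
    rw [Finset.mem_filter] at hj ⊢
    exact ⟨hj.1, by rw [hj.2, hx]⟩
  | read sn =>
    rcases hg with hg | hg
    · rw [hpc] at hg
      cases hg.1
    · rw [hpc] at hg
      cases hg

/-- The result of a read is a written value, which is known to a quorum when the read returns. -/
theorem ReadReturns.known {τ y : ℕ} {v : V} (h : r.ReadReturns τ y v) :
    ∃ σ, r.TerminatesAt τ σ ∧ r.Known y σ ∧ y ≤ ((r.cfg σ).loc w).wSync w ∧
      v = ((r.cfg σ).loc w).history y := by
  obtain ⟨i, a, σ, -, -, hσ, hret, rfl⟩ := h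
  have hinv := r.inv σ
  refine ⟨σ, hσ, ?_⟩
  have hy : r.Known y σ ∧ y ≤ ((r.cfg σ).loc i).wSync i := by
    rcases (enabled hret).2.1 with ⟨hpc, hq⟩ | hpc
    · exact ⟨known_of_card hq, (hinv.loc i).confirming y hpc⟩
    · obtain ⟨hi, hy⟩ := (hinv.loc i).direct y hpc
      refine ⟨known_of_card (i := i) ?_, hy.le⟩
      rw [hy]
      exact (hinv.loc i).quorum hi (by rw [hpc]; nofun)
  exact ⟨hy.1, hy.2.trans (hinv.le_writer i), (hinv.loc i).history_eq y hy.2⟩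

/-- A read returns a value that is at least as recent as those known to a quorum at its start. -/
theorem Known.le_of_readReturns (ht : 2 * t < n) {τ x y : ℕ} {v : V} (hx : r.Known x τ)
    (h : r.ReadReturns τ y v) : x ≤ y := by
  obtain ⟨i, a, σ, ha, hread, ⟨j, ⟨b, hb, -⟩, h1, -, h3⟩, hret, -⟩ := h
  obtain ⟨rfl, rfl⟩ := eq_of_action ha hb
  have hg := (enabled hret).2.1
  cases hread with
  | read =>
    rcases progress_of_invokeRead ht hx h1 ha h3 with h | ⟨⟨k, hk⟩, -⟩ | ⟨y', hy', hxy⟩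
    · exact ((enabled hret).1 h).elim
    · simp [LocalState.Guard, hk] at hg
    · simp only [LocalState.Guard, hy', Pc.confirming.injEq, reduceCtorEq, or_false] at hg
      rw [← hg.1]
      exact hxy
  | directRead =>
    simp only [LocalState.Guard, pc_of_invokeDirectRead h1 ha h3, reduceCtorEq, false_and,
      Pc.direct.injEq, false_or] at hg
    obtain rfl : i = w := (enabled ha).2.1.1
    rw [← hg]
    obtain ⟨j, hj, -⟩ := exists_mem_of_card ht hx hx
    exact hj.trans ((r.inv τ).le_writer j)

/-- A terminated operation is a write or a read with a result. -/
theorem TerminatesAt.isWrite_or_readReturns (ht : 2 * t < n) {τ σ : ℕ}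
    (h : r.TerminatesAt τ σ) : r.IsWrite τ ∨ ∃ y v, r.ReadReturns τ y v := by
  obtain ⟨i, ⟨a, ha, hinv⟩, h1, ⟨b, hb, hb'⟩, h3⟩ := id h
  by_cases hw : r.IsWrite τ
  · exact Or.inl hw
  right
  have hread : a.IsReadInvocation := by
    cases hinv with
    | write v => exact (hw ⟨v, i, ha⟩).elim
    | read => exact .read
    | directRead => exact .directRead
  cases hb' with
  | read sn => exact ⟨sn, _, i, a, σ, ha, hread, h, hb, rfl⟩
  | write =>
    obtain ⟨k, hk, -⟩ := (enabled hb).2.1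
    cases hread with
    | read =>
      rcases progress_of_invokeRead ht (r.known_zero τ) h1 ha h3 with
        h | ⟨⟨k', hk'⟩, -⟩ | ⟨y, hy, -⟩
      · exact ((enabled hb).1 h).elim
      · rw [hk'] at hk
        cases hk
      · rw [hy] at hk
        cases hk
    | directRead =>
      rw [pc_of_invokeDirectRead h1 ha h3] at hk
      cases hk

theorem not_isWrite_of_readReturns {τ y : ℕ} {v : V} (h : r.ReadReturns τ y v) :
    ¬ r.IsWrite τ := by
  rintro ⟨u, hu⟩
  obtain ⟨i, a, σ, ha, hread, -⟩ := h
  obtain ⟨rfl, rfl⟩ := eq_of_action ha (isWriteOf_iff.1 hu)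
  cases hread

/-! ### The three properties of the indices -/

theorem readsWrittenValues (r : Run n t w v₀) : r.ReadsWrittenValues := by
  intro a x v h
  obtain ⟨σ, -, -, hx, rfl⟩ := h.known
  rcases eq_or_ne x 0 with rfl | h0
  · exact Or.inl ⟨rfl, r.history_zero σ⟩
  · exact Or.inr (r.exists_isNthWrite h0 hx)

theorem noReadFromFuture (r : Run n t w v₀) : r.NoReadFromFuture := by
  rintro a x v b y u ha hb ⟨-, σ, hσ, hlt⟩
  obtain ⟨σ', hσ', -, hx, -⟩ := ha.known
  obtain rfl := hσ.unique hσ'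
  have := (isNthWrite_iff.1 hb).2
  have := hx.trans (r.wSync_mono w w hlt.le)
  simp only at this
  omega

theorem noOverwrittenRead (ht : 2 * t < n) (r : Run n t w v₀) : r.NoOverwrittenRead := by
  rintro a x v b y u ha hb ⟨-, σ, hσ, hlt⟩
  exact ((known_of_isNthWrite ha hσ).mono hlt.le).le_of_readReturns ht hb

theorem noNewOldInversion (ht : 2 * t < n) (r : Run n t w v₀) : r.NoNewOldInversion := by
  rintro a x v b y u ha hb ⟨-, σ, hσ, hlt⟩
  obtain ⟨σ', hσ', hx, -⟩ := ha.known
  obtain rfl := hσ.unique hσ'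
  exact (hx.mono hlt.le).le_of_readReturns ht hb

end Run

/-! ### The linearization -/

/-- Elements with finitely many predecessors can be numbered in increasing order. -/
theorem exists_pos_lt_iff {α β : Type*} [LinearOrder β] (S : Set α) (key : α → β)
    (hfin : ∀ a ∈ S, {b | b ∈ S ∧ key b < key a}.Finite) :
    ∃ pos : α → ℕ, ∀ a ∈ S, ∀ b ∈ S, pos a < pos b ↔ key a < key b := by
  have hle : ∀ a ∈ S, ∀ b, key b ≤ key a →
      {c | c ∈ S ∧ key c < key b}.ncard ≤ {c | c ∈ S ∧ key c < key a}.ncard := fun a ha b h =>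
    Set.ncard_le_ncard (fun c hc => ⟨hc.1, hc.2.trans_le h⟩) (hfin a ha)
  refine ⟨fun a => {b | b ∈ S ∧ key b < key a}.ncard, fun a ha b hb => ⟨fun h => ?_, fun h => ?_⟩⟩
  · by_contra! hba
    exact h.not_ge (hle a ha b hba)
  · refine Set.ncard_lt_ncard ⟨fun c hc => ⟨hc.1, hc.2.trans h⟩, fun hsub => ?_⟩ (hfin b hb)
    exact lt_irrefl _ (hsub ⟨ha, h⟩).2

namespace Run

variable {t : ℕ} {w : Fin n} {v₀ : V} {r : Run n t w v₀}

theorem ReadReturns.unique {τ x y : ℕ} {u v : V} (h : r.ReadReturns τ x u)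
    (h' : r.ReadReturns τ y v) : x = y := by
  obtain ⟨i, a, σ, -, -, hσ, hret, -⟩ := h
  obtain ⟨j, b, σ', -, -, hσ', hret', -⟩ := h'
  obtain rfl := hσ.unique hσ'
  cases (eq_of_action hret hret').2
  rfl

open Classical in
/-- The number of a write, or the index of a terminated read (and `0` for anything else). -/
noncomputable def index (r : Run n t w v₀) (τ : ℕ) : ℕ :=
  if r.IsWrite τ then ((r.cfg τ).loc w).wSync w + 1
  else if h : ∃ y v, r.ReadReturns τ y v then h.choose else 0

theorem IsNthWrite.index_eq {x τ : ℕ} {v : V} (h : r.IsNthWrite x τ v) : r.index τ = x := by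
  rw [index, if_pos ⟨v, h.1⟩]
  exact (isNthWrite_iff.1 h).2.symm

theorem ReadReturns.index_eq {y τ : ℕ} {v : V} (h : r.ReadReturns τ y v) : r.index τ = y := by
  have hex : ∃ y v, r.ReadReturns τ y v := ⟨y, v, h⟩
  rw [index, if_neg (not_isWrite_of_readReturns h), dif_pos hex]
  obtain ⟨v', hv'⟩ := hex.choose_spec
  exact hv'.unique h

open Classical in
/-- Operations are sorted by index; the write comes before the reads that return its value, and
these are in the order of their invocations. -/
noncomputable def key (r : Run n t w v₀) (τ : ℕ) : ℕ ×ₗ ℕ ×ₗ ℕ :=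
  toLex (r.index τ, toLex (if r.IsWrite τ then 0 else 1, τ))

theorem key_lt_iff {a b : ℕ} : r.key a < r.key b ↔ r.index a < r.index b ∨
    r.index a = r.index b ∧ (r.IsWrite a ∧ ¬ r.IsWrite b ∨
      (r.IsWrite a ↔ r.IsWrite b) ∧ a < b) := by
  simp only [key, Prod.Lex.toLex_lt_toLex]
  by_cases ha : r.IsWrite a <;> by_cases hb : r.IsWrite b <;> simp [ha, hb]

/-- The operations that take effect: those that terminate, and the writes whose value is read. A
write that is never read and does not terminate is left out, since infinitely many reads may have
to come before it. -/
def effective (r : Run n t w v₀) : Set ℕ :=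
  {a | (∃ σ, r.TerminatesAt a σ) ∨
    ∃ x v, r.IsNthWrite x a v ∧ ∃ b u, r.ReadReturns b x u}

theorem isWrite_or_read_of_mem_effective (ht : 2 * t < n) {a : ℕ} (h : a ∈ r.effective) :
    (∃ x v, r.IsNthWrite x a v) ∨ ∃ y v, r.ReadReturns a y v := by
  rcases h with ⟨σ, h⟩ | ⟨x, v, h, -⟩
  · exact (h.isWrite_or_readReturns ht).imp_left fun ⟨v, hv⟩ => ⟨_, v, hv, rfl⟩
  · exact Or.inl ⟨x, v, h⟩

theorem Precedes.lt {a b : ℕ} (h : r.Precedes a b) : a < b := by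
  obtain ⟨-, σ, hσ, h⟩ := h
  exact hσ.lt.trans h

theorem Precedes.key_lt (ht : 2 * t < n) {a b : ℕ} (hb : b ∈ r.effective)
    (h : r.Precedes a b) : r.key a < r.key b := by
  rw [key_lt_iff]
  have ha : a ∈ r.effective := Or.inl (h.2.imp fun _ h => h.1)
  rcases isWrite_or_read_of_mem_effective ht ha with ⟨x, u, hx⟩ | ⟨x, u, hx⟩ <;>
    rcases isWrite_or_read_of_mem_effective ht hb with ⟨y, v, hy⟩ | ⟨y, v, hy⟩ <;>
    rw [hx.index_eq, hy.index_eq]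
  · exact Or.inl (hx.lt_of_lt hy h.lt)
  · rcases (noOverwrittenRead ht r a x u b y v hx hy h).lt_or_eq with hlt | rfl
    · exact Or.inl hlt
    · exact Or.inr ⟨rfl, Or.inl ⟨⟨u, hx.1⟩, not_isWrite_of_readReturns hy⟩⟩
  · exact Or.inl (noReadFromFuture r a x u b y v hx hy h)
  · rcases (noNewOldInversion ht r a x u b y v hx hy h).lt_or_eq with hlt | rfl
    · exact Or.inl hlt
    · exact Or.inr ⟨rfl, Or.inr ⟨iff_of_false (not_isWrite_of_readReturns hx)
        (not_isWrite_of_readReturns hy), h.lt⟩⟩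

theorem key_lt_of_isNthWrite_of_readReturns {a b x : ℕ} {u v : V} (ha : r.IsNthWrite x a u)
    (hb : r.ReadReturns b x v) : r.key a < r.key b :=
  key_lt_iff.2 (Or.inr ⟨ha.index_eq.trans hb.index_eq.symm,
    Or.inl ⟨⟨u, ha.1⟩, not_isWrite_of_readReturns hb⟩⟩)

theorem isOp_of_mem_effective {a : ℕ} (h : a ∈ r.effective) : r.IsOp a := by
  rcases h with ⟨σ, i, h, -⟩ | ⟨x, v, h, -⟩
  · exact ⟨i, h⟩
  · exact isOp_of_isWriteOf h.1

/-- An effective operation has finitely many predecessors, since some terminated operation is at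
least as large, and what starts after that operation is larger. -/
theorem finite_setOf_key_lt (ht : 2 * t < n) {a : ℕ} (ha : a ∈ r.effective) :
    {b | b ∈ r.effective ∧ r.key b < r.key a}.Finite := by
  obtain ⟨c, σ, hc, hac⟩ : ∃ c σ, r.TerminatesAt c σ ∧ r.key a ≤ r.key c := by
    rcases ha with ⟨σ, h⟩ | ⟨x, v, h, b, u, hb⟩
    · exact ⟨a, σ, h, le_rfl⟩
    · obtain ⟨σ, hσ, -⟩ := hb.known
      exact ⟨b, σ, hσ, (key_lt_of_isNthWrite_of_readReturns h hb).le⟩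
  refine (Set.finite_le_nat σ).subset fun b ⟨hb, hba⟩ => ?_
  by_contra! hlt
  have hcb : r.Precedes c b := ⟨isOp_of_mem_effective hb, σ, hc, by simpa using hlt⟩
  exact ((hcb.key_lt ht hb).trans (hba.trans_le hac)).false

theorem atomic (ht : 2 * t < n) (r : Run n t w v₀) : r.Atomic := by
  obtain ⟨pos, hpos⟩ := exists_pos_lt_iff r.effective r.key fun a ha => finite_setOf_key_lt ht ha
  refine ⟨r.effective, pos, fun a => isOp_of_mem_effective, fun a σ h => Or.inl ⟨σ, h⟩,
    fun a ha b hb hab => ?_, fun a ha b hb hab => (hpos a ha b hb).2 (hab.key_lt ht hb),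
    fun a ha x v h => ?_⟩
  · have h1 : ¬ r.key a < r.key b := by rw [← hpos a ha b hb]; omega
    have h2 : ¬ r.key b < r.key a := by rw [← hpos b hb a ha]; omega
    have h3 := le_antisymm (not_lt.1 h2) (not_lt.1 h1)
    simp only [key, EmbeddingLike.apply_eq_iff_eq, Prod.mk.injEq] at h3
    exact h3.2.2
  · have hwrite : ∀ c ∈ r.effective, r.IsWrite c → pos c < pos a →
        ∃ y u, r.IsNthWrite y c u ∧ y ≠ 0 ∧ y ≤ x := by
      rintro c hc ⟨u, hu⟩ hlt
      have hy : r.IsNthWrite _ c u := ⟨hu, rfl⟩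
      refine ⟨_, u, hy, by rw [(isNthWrite_iff.1 hy).2]; omega, ?_⟩
      rw [← hy.index_eq, ← h.index_eq]
      rcases key_lt_iff.1 ((hpos c hc a ha).1 hlt) with h | h
      exacts [h.le, h.1.le]
    rcases r.readsWrittenValues a x v h with ⟨rfl, rfl⟩ | ⟨b, hb⟩
    · refine Or.inr ⟨rfl, fun c hc hcw hlt => ?_⟩
      obtain ⟨y, u, -, h0, hy⟩ := hwrite c hc hcw hlt
      omega
    · have hbS : b ∈ r.effective := Or.inr ⟨x, v, hb, a, v, h⟩
      refine Or.inl ⟨b, hbS, hb.1, (hpos b hbS a ha).2 (key_lt_of_isNthWrite_of_readReturns hb h),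
        fun c hc hcw hlt => ?_⟩
      obtain ⟨y, u, hyc, -, hy⟩ := hwrite c hc hcw hlt
      rcases (hyc.le_of_le hb hy).lt_or_eq with hcb | rfl
      · refine ((hpos c hc b hbS).2 (key_lt_iff.2 (Or.inl ?_))).le
        rw [hyc.index_eq, hb.index_eq]
        exact hyc.lt_of_lt hb hcb
      · exact le_rfl

/-! ### Liveness -/

theorem card_correct (r : Run n t w v₀) [DecidablePred r.Correct] :
    n - t ≤ (Finset.univ.filter r.Correct).card := by
  have h := r.crash_le
  have h' : {i | ∃ τ, i ∈ (r.cfg τ).crashed} = ↑(Finset.univ.filter fun i => ¬ r.Correct i) := by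
    ext i
    rw [Finset.mem_coe, Finset.mem_filter]
    simp [Correct]
  rw [h', Set.ncard_coe_finset] at h
  have := Finset.card_filter_add_card_filter_not (s := Finset.univ) r.Correct
  rw [Finset.card_univ, Fintype.card_fin] at this
  omega

/-- Fairness: a block of a correct process that is enabled from some time on, unless it is
executed, is executed. -/
theorem Fair.exists_action (hf : r.Fair) {i : Fin n} (hi : r.Correct i) {a : Action n V}
    (ha : ¬ a.IsInvocation) {τ : ℕ}
    (h : ∀ σ, τ ≤ σ → (∀ ρ, τ ≤ ρ → ρ < σ → (r.ev ρ).action ≠ some (i, a)) →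
      ((r.cfg σ).loc i).Guard t w i a ∧ ∀ j m, a = .receive j m → m ∈ (r.cfg σ).chan j i) :
    ∃ σ, τ ≤ σ ∧ (r.ev σ).action = some (i, a) := by
  by_contra! hne
  obtain ⟨σ, hσ, h'⟩ := hf i hi a ha τ fun σ hσ =>
    ⟨hi σ, h σ hσ fun ρ hρ _ => hne ρ hρ⟩
  exact hne σ hσ (by rw [h']; rfl)

/-- Channels are reliable. -/
theorem Fair.exists_receive (hf : r.Fair) {i j : Fin n} (hi : r.Correct i) {m : Msg V} {τ : ℕ}
    (hm : m ∈ (r.cfg τ).chan j i) :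
    ∃ σ, τ ≤ σ ∧ (r.ev σ).action = some (i, .receive j m) := by
  refine hf.exists_action hi (a := .receive j m) nofun fun σ hσ hne => ⟨trivial, ?_⟩
  intro k m' h
  cases h
  induction σ, hσ using Nat.le_induction with
  | base => exact hm
  | succ σ hσ ih =>
    exact mem_chan_succ (ih fun ρ h h' => hne ρ h (by omega)) (hne σ hσ (by omega))

/-- A message WRITE whose bit is the expected one is processed eventually. -/
theorem Fair.exists_wSync_lt_of_mem_waitW (hf : r.Fair) {i j : Fin n} (hi : r.Correct i) {τ : ℕ}
    {b : Bool} {v : V} (hm : (j, b, v) ∈ ((r.cfg τ).loc i).waitW)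
    (hb : b = Nat.bodd (((r.cfg τ).loc i).wSync j + 1)) :
    ∃ σ, τ ≤ σ ∧ ((r.cfg τ).loc i).wSync j < ((r.cfg σ).loc i).wSync j := by
  classical
  by_contra! hne
  have hsync : ∀ σ, τ ≤ σ → ((r.cfg σ).loc i).wSync j = ((r.cfg τ).loc i).wSync j := fun σ hσ =>
    (hne σ hσ).antisymm (r.wSync_mono i j hσ)
  have hexec : ∀ σ, τ ≤ σ → ∀ b' v', (r.ev σ).action ≠ some (i, .handleWrite j b' v') := by
    intro σ hσ b' v' h
    have h1 := hsync (σ + 1) (by omega)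
    have hj : j ≠ i := ((r.inv σ).fits (enabled h) (by simp)).1
    rw [loc_succ h, LocalState.exec_handleWrite_wSync] at h1
    have h2 := hsync σ hσ
    split_ifs at h1 <;> simp at h1 <;> omega
  have hmem : ∀ σ, τ ≤ σ → (j, b, v) ∈ ((r.cfg σ).loc i).waitW := by
    intro σ hσ
    induction σ, hσ using Nat.le_induction with
    | base => exact hm
    | succ σ hσ ih =>
      rcases r.loc_succ_or σ i with ⟨a, ha⟩ | h'
      · rw [loc_succ ha]
        cases a with
        | handleWrite k b' v' =>
          rw [LocalState.exec_handleWrite_waitW]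
          refine (Multiset.mem_erase_of_ne ?_).2 ih
          rintro h'
          cases h'
          exact hexec σ hσ _ _ ha
        | receive k m =>
          cases m with
          | write b' v' => exact Multiset.mem_cons_of_mem ih
          | _ => exact ih
        | _ => exact ih
      · rwa [h']
  obtain ⟨σ, hσ, h⟩ := hf.exists_action hi (a := .handleWrite j b v) (τ := τ) nofun
    fun σ hσ _ => ⟨⟨hmem σ hσ, by rw [hsync σ hσ, hb]⟩, nofun⟩
  exact hexec σ hσ _ _ h

theorem Fair.exists_wSync_lt_of_mem_inFlight (hf : r.Fair) {i j : Fin n} (hi : r.Correct i)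
    {τ : ℕ} {b : Bool} {v : V} (hm : (b, v) ∈ (r.cfg τ).inFlight j i)
    (hb : b = Nat.bodd (((r.cfg τ).loc i).wSync j + 1)) :
    ∃ σ, τ ≤ σ ∧ ((r.cfg τ).loc i).wSync j < ((r.cfg σ).loc i).wSync j := by
  rcases mem_inFlight.1 hm with hm | hm
  · obtain ⟨σ, hσ, h⟩ := hf.exists_receive hi hm
    have hle : ((r.cfg τ).loc i).wSync j ≤ ((r.cfg (σ + 1)).loc i).wSync j :=
      r.wSync_mono i j (by omega : τ ≤ σ + 1)
    rcases hle.lt_or_eq with hlt | he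
    · exact ⟨σ + 1, by omega, hlt⟩
    rw [he] at hb ⊢
    obtain ⟨ρ, hρ, h'⟩ := hf.exists_wSync_lt_of_mem_waitW hi (τ := σ + 1) (b := b) (v := v) (by
      rw [loc_succ h]
      exact Multiset.mem_cons_self _ _) hb
    exact ⟨ρ, by omega, h'⟩
  · exact hf.exists_wSync_lt_of_mem_waitW hi hm hb

/-- The exchange between two correct processes never stalls: a value known to one of them becomes
known to the other, and this becomes known to the first. -/
theorem Fair.exists_le_wSync (hf : r.Fair) {i j : Fin n} (hi : r.Correct i) (hj : r.Correct j)
    {x τ : ℕ} (hx : x ≤ ((r.cfg τ).loc i).wSync i) :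
    ∃ σ, τ ≤ σ ∧ x ≤ ((r.cfg σ).loc j).wSync i := by
  induction x generalizing i j τ with
  | zero => exact ⟨τ, le_rfl, Nat.zero_le _⟩
  | succ x ih =>
    rcases eq_or_ne i j with rfl | hij
    · exact ⟨τ, le_rfl, hx⟩
    obtain ⟨σ, hσ, h1⟩ := ih hi hj (by omega : x ≤ ((r.cfg τ).loc i).wSync i)
    obtain ⟨ρ, hρ, h2⟩ := ih hj hi (h1.trans (((r.inv σ).loc j).sync_le i))
    -- Each of the two knows that the other knows the value number `x`, so `i` has sent the next
    -- one to `j`.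
    obtain ⟨k, -, -, hk, hfl⟩ := (r.inv ρ).flow i j hij
    have hk := hk (hi ρ)
    have hxi : ((r.cfg τ).loc i).wSync i ≤ ((r.cfg ρ).loc i).wSync i :=
      r.wSync_mono i i (by omega : τ ≤ ρ)
    have hxj : ((r.cfg σ).loc j).wSync i ≤ ((r.cfg ρ).loc j).wSync i := r.wSync_mono j i hρ
    rcases (h1.trans hxj).lt_or_eq with hlt | he
    · exact ⟨ρ, by omega, hlt⟩
    obtain ⟨ρ', hρ', h3⟩ := hf.exists_wSync_lt_of_mem_inFlight hj (i := j) (j := i) (τ := ρ)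
      (by rw [hfl]; exact mem_segment.2 ⟨_, Nat.lt_succ_self _, by omega, rfl⟩) rfl
    exact ⟨ρ', by omega, by omega⟩

theorem exists_forall_correct_of_mono {P : Fin n → ℕ → Prop} (hP : ∀ j, Monotone (P j)) {τ : ℕ}
    (h : ∀ j, r.Correct j → ∃ σ, τ ≤ σ ∧ P j σ) :
    ∃ σ, τ ≤ σ ∧ ∀ j, r.Correct j → P j σ := by
  -- The time `τ` stands in for the processes that are not correct.
  have h' : ∀ j, ∃ σ, τ ≤ σ ∧ (r.Correct j → P j σ) := fun j => by
    by_cases hj : r.Correct j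
    · exact (h j hj).imp fun σ hσ => ⟨hσ.1, fun _ => hσ.2⟩
    · exact ⟨τ, le_rfl, fun h => (hj h).elim⟩
  choose f hf hf' using h'
  refine ⟨τ + ∑ j, f j, by omega, fun j hj => hP j ?_ (hf' j hj)⟩
  exact (Finset.single_le_sum (fun _ _ => Nat.zero_le _) (Finset.mem_univ j)).trans
    (Nat.le_add_left _ _)

/-- A value known to a correct process is eventually known to a quorum, to the knowledge of that
process. -/
theorem Fair.exists_card (hf : r.Fair) {i : Fin n} (hi : r.Correct i) {x τ : ℕ}
    (hx : x ≤ ((r.cfg τ).loc i).wSync i) :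
    ∃ σ, τ ≤ σ ∧ ∀ ρ, σ ≤ ρ →
      n - t ≤ (Finset.univ.filter fun j => x ≤ ((r.cfg ρ).loc i).wSync j).card := by
  classical
  obtain ⟨σ, hσ, h⟩ := exists_forall_correct_of_mono (r := r)
    (P := fun j σ => x ≤ ((r.cfg σ).loc i).wSync j) (τ := τ)
    (fun j σ ρ h hx => le_trans hx (r.wSync_mono i j h)) fun j hj => by
      obtain ⟨σ, hσ, h1⟩ := hf.exists_le_wSync hi hj hx
      obtain ⟨ρ, hρ, h2⟩ := hf.exists_le_wSync hj hi (h1.trans (((r.inv σ).loc j).sync_le i))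
      exact ⟨ρ, by omega, h2⟩
  refine ⟨σ, hσ, fun ρ hρ => r.card_correct.trans (Finset.card_le_card fun j hj => ?_)⟩
  rw [Finset.mem_filter] at hj ⊢
  exact ⟨hj.1, (h j hj.2).trans (r.wSync_mono i j hρ)⟩

theorem rSync_mono (r : Run n t w v₀) (i j : Fin n) :
    Monotone fun τ => ((r.cfg τ).loc i).rSync j := by
  refine monotone_nat_of_le_succ fun τ => ?_
  rcases r.loc_succ_or τ i with ⟨a, ha⟩ | h
  · change _ ≤ ((r.cfg (τ + 1)).loc i).rSync j
    rw [loc_succ ha]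
    by_cases h₁ : a = .invokeRead
    · subst h₁
      simp only [LocalState.exec, Function.update_apply]
      split_ifs <;> subst_vars <;> omega
    by_cases h₂ : ∃ k, a = .receive k .proceed
    · obtain ⟨k, rfl⟩ := h₂
      simp only [LocalState.exec, Function.update_apply]
      split_ifs <;> subst_vars <;> omega
    push Not at h₂
    rw [LocalState.exec_rSync_of_ne h₁ h₂]
  · exact (congrArg (fun s => s.rSync j) h).ge

theorem le_wSync_of_mem_waitR (r : Run n t w v₀) (τ : ℕ) (i : Fin n) :
    ∀ e ∈ ((r.cfg τ).loc i).waitR, e.2 ≤ ((r.cfg τ).loc i).wSync i := by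
  induction τ with
  | zero => simp [r.cfg_zero, Config.start]
  | succ τ ih =>
    intro e he
    have hle : ((r.cfg τ).loc i).wSync i ≤ ((r.cfg (τ + 1)).loc i).wSync i :=
      r.wSync_mono i i (Nat.le_succ τ)
    refine le_trans ?_ hle
    rcases r.loc_succ_or τ i with ⟨a, ha⟩ | h
    · rw [loc_succ ha] at he
      cases a with
      | receive k m =>
        cases m with
        | read =>
          rcases Multiset.mem_cons.1 he with rfl | he
          exacts [le_rfl, ih e he]
        | _ => exact ih e he
      | handleRead k sn => exact ih e (Multiset.mem_of_mem_erase he)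
      | handleWrite k b v =>
        rw [LocalState.exec_handleWrite_waitR] at he
        exact ih e he
      | _ => exact ih e he
    · rw [h] at he
      exact ih e he

theorem Fair.exists_rSync_lt_of_proceed (hf : r.Fair) {i j : Fin n} (hi : r.Correct i) {τ : ℕ}
    (h : .proceed ∈ (r.cfg τ).chan j i) :
    ∃ σ, τ ≤ σ ∧ ((r.cfg τ).loc i).rSync j < ((r.cfg σ).loc i).rSync j := by
  obtain ⟨σ, hσ, h⟩ := hf.exists_receive hi h
  refine ⟨σ + 1, by omega, ?_⟩
  have : ((r.cfg τ).loc i).rSync j ≤ ((r.cfg σ).loc i).rSync j := r.rSync_mono i j hσ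
  rw [loc_succ h]
  simp only [LocalState.exec, Function.update_self]
  omega

/-- A READ message received from a correct process is answered: the process is told all the values
known at the reception, and reports back that it has learnt them. -/
theorem Fair.exists_proceed_of_mem_waitR (hf : r.Fair) {i j : Fin n} (hi : r.Correct i)
    (hj : r.Correct j) {τ sn : ℕ} (h : (i, sn) ∈ ((r.cfg τ).loc j).waitR)
    (hsn : sn ≤ ((r.cfg τ).loc j).wSync j) :
    ∃ σ, τ ≤ σ ∧ .proceed ∈ (r.cfg σ).chan j i := by
  classical
  obtain ⟨τ₁, hτ₁, h1⟩ := hf.exists_le_wSync hj hi hsn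
  obtain ⟨τ₂, hτ₂, h2⟩ := hf.exists_le_wSync hi hj (h1.trans (((r.inv τ₁).loc i).sync_le j))
  have key : ∀ σ, τ ≤ σ → (∃ ρ, τ ≤ ρ ∧ ρ < σ ∧ (r.ev ρ).action = some (j, .handleRead i sn)) ∨
      (i, sn) ∈ ((r.cfg σ).loc j).waitR := by
    intro σ hσ
    induction σ, hσ using Nat.le_induction with
    | base => exact Or.inr h
    | succ σ hσ ih =>
      rcases ih with ⟨ρ, h, h', h''⟩ | ih
      · exact Or.inl ⟨ρ, h, by omega, h''⟩
      rcases r.loc_succ_or σ j with ⟨a, ha⟩ | h'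
      · by_cases h₂ : a = .handleRead i sn
        · exact Or.inl ⟨σ, hσ, by omega, by rw [ha, h₂]⟩
        right
        rw [loc_succ ha]
        cases a with
        | handleRead k sn' =>
          refine (Multiset.mem_erase_of_ne ?_).2 ih
          rintro h'
          cases h'
          exact h₂ rfl
        | receive k m =>
          cases m with
          | read => exact Multiset.mem_cons_of_mem ih
          | _ => exact ih
        | handleWrite k b v => rwa [LocalState.exec_handleWrite_waitR]
        | _ => exact ih
      · exact Or.inr (by rwa [h'])
  obtain ⟨ρ, hρ, h3⟩ : ∃ ρ, τ ≤ ρ ∧ (r.ev ρ).action = some (j, .handleRead i sn) := by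
    rcases key τ₂ (by omega) with ⟨ρ, h, -, h'⟩ | -
    · exact ⟨ρ, h, h'⟩
    by_contra! hne
    obtain ⟨ρ, hρ, h3⟩ := hf.exists_action hj (a := .handleRead i sn) (τ := τ₂) nofun
      fun σ hσ _ => ⟨⟨(key σ (by omega)).resolve_left fun ⟨ρ, h, _, h'⟩ => hne ρ h h',
        h2.trans (r.wSync_mono j i hσ)⟩, nofun⟩
    exact hne ρ (by omega) h3
  refine ⟨ρ + 1, by omega, mem_chan_of_mem_sends h3 (hj _) ?_⟩
  simp [LocalState.sends]

/-- An unanswered READ message gets its answer. -/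
theorem Fair.exists_rSync_lt (hf : r.Fair) {i j : Fin n} (hi : r.Correct i)
    (hj : r.Correct j) {τ : ℕ} (h : ((r.cfg τ).loc i).rSync j < ((r.cfg τ).loc i).rSync i) :
    ∃ σ, τ ≤ σ ∧ ((r.cfg τ).loc i).rSync j < ((r.cfg σ).loc i).rSync j := by
  have hij : i ≠ j := by
    rintro rfl
    exact lt_irrefl _ h
  suffices h' : ∃ σ, τ ≤ σ ∧ .proceed ∈ (r.cfg σ).chan j i by
    obtain ⟨σ, hσ, h'⟩ := h'
    obtain ⟨ρ, hρ, h''⟩ := hf.exists_rSync_lt_of_proceed hi h'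
    exact ⟨ρ, by omega, lt_of_le_of_lt (r.rSync_mono i j hσ) h''⟩
  have hp : (r.cfg τ).pendingReads i j ≠ 0 := by
    have := ((r.inv τ).reads i j hij).2 (hi τ) (hj τ)
    omega
  have hp' : (∃ m ∈ (r.cfg τ).chan i j, m.isRead) ∨
      (∃ e ∈ ((r.cfg τ).loc j).waitR, e.1 = i) ∨ ∃ m ∈ (r.cfg τ).chan j i, m.isProceed := by
    simp only [← Multiset.countP_pos]
    simp only [Config.pendingReads] at hp
    omega
  have hwait : ∀ {σ}, τ ≤ σ → (∃ e ∈ ((r.cfg σ).loc j).waitR, e.1 = i) →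
      ∃ σ, τ ≤ σ ∧ .proceed ∈ (r.cfg σ).chan j i := by
    rintro σ hσ ⟨⟨_, sn⟩, he, rfl⟩
    obtain ⟨ρ, hρ, h⟩ := hf.exists_proceed_of_mem_waitR hi hj he (r.le_wSync_of_mem_waitR σ j _ he)
    exact ⟨ρ, by omega, h⟩
  rcases hp' with ⟨m, hm, hread⟩ | hm | ⟨m, hm, hproc⟩
  · cases m with
    | read =>
      obtain ⟨σ, hσ, h⟩ := hf.exists_receive hj hm
      refine hwait (σ := σ + 1) (by omega) ⟨(i, ((r.cfg σ).loc j).wSync j), ?_, rfl⟩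
      rw [loc_succ h]
      exact Multiset.mem_cons_self _ _
    | _ => cases hread
  · exact hwait le_rfl hm
  · cases m with
    | proceed => exact ⟨τ, le_rfl, hm⟩
    | _ => cases hproc

theorem Fair.exists_rSync_le (hf : r.Fair) {i j : Fin n} (hi : r.Correct i)
    (hj : r.Correct j) {x τ : ℕ} (h : x ≤ ((r.cfg τ).loc i).rSync i) :
    ∃ σ, τ ≤ σ ∧ x ≤ ((r.cfg σ).loc i).rSync j := by
  induction x with
  | zero => exact ⟨τ, le_rfl, Nat.zero_le _⟩
  | succ x ih =>
    obtain ⟨σ, hσ, h1⟩ := ih (by omega)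
    have h2 : ((r.cfg τ).loc i).rSync i ≤ ((r.cfg σ).loc i).rSync i := r.rSync_mono i i hσ
    by_cases hx : x + 1 ≤ ((r.cfg σ).loc i).rSync j
    · exact ⟨σ, hσ, hx⟩
    · obtain ⟨ρ, hρ, h3⟩ := hf.exists_rSync_lt hi hj (by omega : _ < ((r.cfg σ).loc i).rSync i)
      exact ⟨ρ, by omega, by omega⟩

theorem Fair.exists_return_of_writing (hf : r.Fair) {i : Fin n} (hi : r.Correct i) {τ x : ℕ}
    (h : ((r.cfg τ).loc i).pc = .writing x) : ∃ σ, τ ≤ σ ∧ r.ReturnBy σ i := by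
  by_contra! hne
  have hpc : ∀ σ, τ ≤ σ → ((r.cfg σ).loc i).pc = .writing x := fun σ hσ => by
    rw [← h]
    exact pc_eq_of_not_return hσ (by rw [h]; nofun) (by rw [h]; nofun) fun ρ h _ => hne ρ h
  obtain ⟨τ₁, hτ₁, hq⟩ := hf.exists_card hi (((r.inv τ).loc i).writing x h).2.le
  obtain ⟨σ, hσ, h'⟩ := hf.exists_action hi (a := .returnWrite) (τ := τ₁) nofun fun σ hσ _ => by
    refine ⟨⟨x, hpc σ (by omega), (hq σ hσ).trans (Finset.card_le_card fun j hj => ?_)⟩, nofun⟩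
    have hloc := (r.inv σ).loc i
    rw [Finset.mem_filter] at hj ⊢
    refine ⟨hj.1, le_antisymm ?_ hj.2⟩
    rw [(hloc.writing x (hpc σ (by omega))).2]
    exact hloc.sync_le j
  exact hne σ (by omega) ⟨_, h', .write⟩

theorem Fair.exists_return_of_direct (hf : r.Fair) {i : Fin n} (hi : r.Correct i) {τ x : ℕ}
    (h : ((r.cfg τ).loc i).pc = .direct x) : ∃ σ, τ ≤ σ ∧ r.ReturnBy σ i := by
  by_contra! hne
  obtain ⟨σ, hσ, h'⟩ := hf.exists_action hi (a := .returnRead x) (τ := τ) nofun fun σ hσ _ => by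
    refine ⟨Or.inr ?_, nofun⟩
    rw [← h]
    exact pc_eq_of_not_return hσ (by rw [h]; nofun) (by rw [h]; nofun) fun ρ h _ => hne ρ h
  exact hne σ hσ ⟨_, h', .read x⟩

theorem Fair.exists_return_of_confirming (hf : r.Fair) {i : Fin n} (hi : r.Correct i) {τ x : ℕ}
    (h : ((r.cfg τ).loc i).pc = .confirming x) : ∃ σ, τ ≤ σ ∧ r.ReturnBy σ i := by
  by_contra! hne
  obtain ⟨τ₁, hτ₁, hq⟩ := hf.exists_card hi (((r.inv τ).loc i).confirming x h)
  obtain ⟨σ, hσ, h'⟩ := hf.exists_action hi (a := .returnRead x) (τ := τ₁) nofun fun σ hσ _ => by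
    refine ⟨Or.inl ⟨?_, hq σ hσ⟩, nofun⟩
    rw [← h]
    exact pc_eq_of_not_return (by omega) (by rw [h]; nofun) (by rw [h]; nofun)
      fun ρ h _ => hne ρ h
  exact hne σ (by omega) ⟨_, h', .read x⟩

theorem Fair.exists_return_of_reading (hf : r.Fair) {i : Fin n} (hi : r.Correct i) {τ x : ℕ}
    (h : ((r.cfg τ).loc i).pc = .reading x) : ∃ σ, τ ≤ σ ∧ r.ReturnBy σ i := by
  classical
  by_contra! hne
  by_cases hc : ∃ σ, τ ≤ σ ∧ (r.ev σ).action = some (i, .confirmRead)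
  · obtain ⟨σ, hσ, hc⟩ := hc
    obtain ⟨ρ, hρ, h'⟩ := hf.exists_return_of_confirming hi (τ := σ + 1)
      (x := ((r.cfg σ).loc i).wSync i) (by rw [loc_succ hc]; rfl)
    exact hne ρ (by omega) h'
  push Not at hc
  have hpc : ∀ σ, τ ≤ σ → ((r.cfg σ).loc i).pc = .reading x := by
    intro σ hσ
    induction σ, hσ using Nat.le_induction with
    | base => exact h
    | succ σ hσ ih =>
      exact ((pc_succ (hne σ hσ) (by rw [ih]; nofun)).resolve_right (hc σ hσ)).trans ih
  have hx : ∀ σ, τ ≤ σ → x = ((r.cfg σ).loc i).rSync i := fun σ hσ =>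
    ((r.inv σ).loc i).reading x (hpc σ hσ)
  obtain ⟨τ₁, hτ₁, hq⟩ := exists_forall_correct_of_mono (r := r)
    (P := fun j σ => x ≤ ((r.cfg σ).loc i).rSync j) (τ := τ)
    (fun j σ ρ h hx => le_trans hx (r.rSync_mono i j h))
    fun j hj => hf.exists_rSync_le hi hj (hx τ le_rfl).le
  obtain ⟨σ, hσ, h'⟩ := hf.exists_action hi (a := .confirmRead) (τ := τ₁) nofun fun σ hσ _ => by
    refine ⟨⟨x, hpc σ (by omega), r.card_correct.trans (Finset.card_le_card fun j hj => ?_)⟩, nofun⟩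
    rw [Finset.mem_filter] at hj ⊢
    refine ⟨hj.1, le_antisymm ?_ ((hq j hj.2).trans (r.rSync_mono i j hσ))⟩
    rw [hx σ (by omega)]
    rcases eq_or_ne i j with rfl | hij
    · exact le_rfl
    · exact (Nat.le_add_left _ _).trans ((r.inv σ).reads i j hij).1
  exact hc σ (by omega) h'

theorem Fair.live (hf : r.Fair) : r.Live := by
  classical
  intro τ i hop hi
  have hret : ∃ σ, τ < σ ∧ r.ReturnBy σ i := by
    obtain ⟨a, ha, hinv⟩ := hop
    have hs := loc_succ ha
    cases hinv with
    | write v => exact hf.exists_return_of_writing hi (τ := τ + 1) (by rw [hs]; rfl)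
    | read => exact hf.exists_return_of_reading hi (τ := τ + 1) (by rw [hs]; rfl)
    | directRead => exact hf.exists_return_of_direct hi (τ := τ + 1) (by rw [hs]; rfl)
  refine ⟨Nat.find hret, i, hop, (Nat.find_spec hret).1, (Nat.find_spec hret).2,
    fun σ h1 h2 h3 => ?_⟩
  exact Nat.find_min hret h2 ⟨h1, h3⟩

end Run

end TwoBit

theorem theorem1 {V : Type*} (n t : ℕ) (ht : 2 * t < n) (w : Fin n) (v₀ : V)
    (r : TwoBit.Run n t w v₀) :
    (r.Fair → r.Live) ∧ r.Atomic ∧ r.ReadsWrittenValues ∧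
      r.NoReadFromFuture ∧ r.NoOverwrittenRead ∧ r.NoNewOldInversion :=
  ⟨fun hf => hf.live, r.atomic ht, r.readsWrittenValues, r.noReadFromFuture,
    r.noOverwrittenRead ht, r.noNewOldInversion ht⟩
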